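/- **Setting.** Let $d\ge 1$, let $\mathcal X\subseteq\mathbb R^d$ be bounded and convex, and let $Q\neq 0$ be a finite Borel measure on $\mathbb R$. For $\alpha\in\mathcal S_{d-1}=\{\alpha\in\mathbb R^d:\|\alpha\|=1\}$ put $\mathcal C_\alpha=\{\alpha^\top x: x\in\mathcal X\}$ and let $\mathcal F_\alpha$ be the set of functions $F:\mathcal C_\alpha\times\mathbb R\to[0,1]$ such that $F(z,\cdot)$ is a cumulative distribution function for each $z$ and $F(\cdot,y)$ is non-increasing for each $y$. Let $(X_1,Y_1),(X_2,Y_2),\dots$ be i.i.d. copies of $(X,Y)\in\mathcal X\times\mathbb R$, where for some $\alpha_0\in\mathcal S_{d-1}$ and $F_0\in\mathcal F_{\alpha_0}$ $$\mathbb P(Y\le y\mid X=x)=F_0(\alpha_0^\top x,y)\qquad\text{for all }y\in\mathbb R\text{ and }\mathbb P^X\text{-almost every }x .$$ **Estimator.** For each $n$, $(\hat F_n,\hat\alpha_n)$ is a (measurable) minimizer of $$L_n(Q;F,\alpha)=\frac1n\sum_{i=1}^n\int_{\mathbb R}\bigl(1\{Y_i\le t\}-F(\alpha^\top X_i,t)\bigr)^2\,dQ(t)$$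 over all $\alpha\in\mathcal S_{d-1}$, $F\in\mathcal F_\alpha$, such that, with $z_1<\dots<z_m$ the distinct values of $\hat\alpha_n^\top X_1,\dots,\hat\alpha_n^\top X_n$, for all $i$ and all $t\in\mathrm{supp}(Q)$, $$\hat F_n(z_i,t)=\min_{k\le i}\ \max_{l\ge i}\ \frac{\#\{s: z_k\le\hat\alpha_n^\top X_s\le z_l,\ Y_s\le t\}}{\#\{s: z_k\le\hat\alpha_n^\top X_s\le z_l\}} ;$$ elsewhere $\hat F_n$ is any extension that belongs to $\mathcal F_{\hat\alpha_n}$. **Theorem.** Assume: 1. One of the following holds. (a) $X$ has a Lebesgue density on $\mathcal X$ bounded below by a positive constant and above by a finite constant, and $Q$ has finite support. (b) For $\mathbb P^Y$-almost every $y$, the conditional distribution of $X$ given $Y=y$ has a Lebesgue density on $\mathcal X$ bounded below by a positive constant and above by a finite constant, both independent of $y$, and $Q$ is concentrated on a compact interval and has a bounded Lebesgue density. 2. There is $\bar q<\infty$ such that for every $\alpha\in\mathcal S_{d-1}$ the variable $\alpha^\top X$ has a Lebesgue density bounded by $\bar q$. 3. For each $t\in\mathrm{supp}(Q)$ the function $F_0(\cdot,t)$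 on $\mathcal C_{\alpha_0}$ is left-continuous, non-constant, and has no discontinuity point on the boundary of $\mathcal C_{\alpha_0}$. 4. From each subsequence $(n_k)$ one can extract a further subsequence $(n_{k_l})$ such that, almost surely, $$\lim_{l\to\infty}\int_{\mathbb R}\int_{\mathcal X}\bigl(F_0(\alpha_0^\top x,t)-\hat F_{n_{k_l}}(\hat\alpha_{n_{k_l}}^\top x,t)\bigr)^2\,d\mathbb P^X(x)\,dQ(t)=0 .$$ Then (i) $\hat\alpha_n\to\alpha_0$ in probability in the Euclidean norm; (ii) for every $(z,t)\in\mathcal C_{\alpha_0}^\circ\times\mathrm{supp}(Q)$ at which $F_0$, restricted to $\mathcal C_{\alpha_0}\times\mathrm{supp}(Q)$, is continuous (in particular at every continuity point of $F_0$ in that set), $\hat F_n(z,t)\to F_0(z,t)$ in probability. -/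

import Mathlib

open MeasureTheory ProbabilityTheory Filter Topology

noncomputable section

namespace DSIM

/-- The covariate space `ℝᵈ` with its Euclidean norm. -/
abbrev Cov (d : ℕ) : Type := EuclideanSpace ℝ (Fin d)

/-- The set `C_α = {αᵀx : x ∈ 𝒳}` of index values. -/
def indexSet {d : ℕ} (𝒳 : Set (Cov d)) (α : Cov d) : Set ℝ :=
  (fun x : Cov d => inner ℝ α x) '' 𝒳

/-- `G` is a cumulative distribution function on `ℝ`. -/
structure IsCDF (G : ℝ → ℝ) : Prop where
  mono : Monotone G
  right_cont : ∀ y, ContinuousWithinAt G (Set.Ici y) y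
  tendsto_bot : Tendsto G atBot (𝓝 0)
  tendsto_top : Tendsto G atTop (𝓝 1)

/-- The class `𝓕_α` of functions `F` on `C_α × ℝ` such that `F(z, ·)` is a distribution function and
`F(·, y)` is non-increasing. Values of `F z y` with `z ∉ C_α` are irrelevant. -/
structure MemClass {d : ℕ} (𝒳 : Set (Cov d)) (α : Cov d) (F : ℝ → ℝ → ℝ) : Prop where
  cdf : ∀ z ∈ indexSet 𝒳 α, IsCDF (F z)
  anti : ∀ y : ℝ, AntitoneOn (fun z => F z y) (indexSet 𝒳 α)

/-- `ν` is concentrated on `S` and has there a Lebesgue density with values in `[lo, hi]`. -/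
def HasDensityBetween {E : Type*} [MeasureSpace E] (ν : Measure E) (S : Set E) (lo hi : ℝ) : Prop :=
  ∃ p : E → ℝ, Measurable p ∧ (∀ x ∈ S, lo ≤ p x ∧ p x ≤ hi) ∧
    ν = (volume.restrict S).withDensity (fun x => ENNReal.ofReal (p x))

/-- The distributional single index model: `(F₀, α₀)` lies in the model class and
`P(Y ≤ y | X = x) = F₀(α₀ᵀx, y)`, where `P` is the joint law of `(X, Y)`. -/
structure IsModel {d : ℕ} (𝒳 : Set (Cov d)) (P : Measure (Cov d × ℝ)) [IsFiniteMeasure P]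
    (F₀ : ℝ → ℝ → ℝ) (α₀ : Cov d) : Prop where
  norm_index : ‖α₀‖ = 1
  mem_class : MemClass 𝒳 α₀ F₀
  cond : ∀ᵐ x ∂P.fst, ∀ y : ℝ, P.condKernel x (Set.Iic y) = ENNReal.ofReal (F₀ (inner ℝ α₀ x) y)

/-- The covariates have a density on `𝒳` that is bounded away from zero and infinity, and `Q` has
finite support. -/
def DiscreteWeight {d : ℕ} (𝒳 : Set (Cov d)) (P : Measure (Cov d × ℝ)) (Q : Measure ℝ) : Prop :=
  (∃ lo hi : ℝ, 0 < lo ∧ HasDensityBetween P.fst 𝒳 lo hi) ∧ Q.support.Finite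

/-- The conditional laws of `X` given `Y = y` have densities on `𝒳` that are bounded away from zero
and infinity, uniformly in `y`, and `Q` lives on a compact interval and has a bounded density. -/
def ContinuousWeight {d : ℕ} (𝒳 : Set (Cov d)) (P : Measure (Cov d × ℝ)) [IsFiniteMeasure P]
    (Q : Measure ℝ) : Prop :=
  (∃ lo hi : ℝ, 0 < lo ∧
    ∀ᵐ y ∂P.snd, HasDensityBetween ((P.map Prod.swap).condKernel y) 𝒳 lo hi) ∧
  ∃ a b c : ℝ, HasDensityBetween Q (Set.Icc a b) 0 c

/-- The weighted least squares criterion `L_n(Q; F, α)` for the data `(x i, y i)`. -/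
def criterion {d n : ℕ} (Q : Measure ℝ) (x : Fin n → Cov d) (y : Fin n → ℝ)
    (F : ℝ → ℝ → ℝ) (α : Cov d) : ℝ :=
  (1 / (n : ℝ)) * ∑ i : Fin n,
    ∫ t, ((if y i ≤ t then (1 : ℝ) else 0) - F (inner ℝ α (x i)) t) ^ 2 ∂Q

/-- The proportion of responses `≤ t` among the observations whose index lies in `[u, v]`. -/
def slabMean {d n : ℕ} (x : Fin n → Cov d) (y : Fin n → ℝ) (α : Cov d) (u v t : ℝ) : ℝ :=
  (Nat.card {s : Fin n // inner ℝ α (x s) ∈ Set.Icc u v ∧ y s ≤ t} : ℝ) /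
    (Nat.card {s : Fin n // inner ℝ α (x s) ∈ Set.Icc u v} : ℝ)

/-- Isotonic distributional regression along the direction `α`, evaluated at the index value of the
`i`-th observation and at threshold `t` (min-max formula; `k` and `l` run over observations with
index at most, respectively at least, that of observation `i`, so ties are pooled). -/
def isotonicFit {d n : ℕ} (x : Fin n → Cov d) (y : Fin n → ℝ) (α : Cov d) (i : Fin n) (t : ℝ) : ℝ :=
  ⨅ k : {k : Fin n // inner ℝ α (x k) ≤ inner ℝ α (x i)},
    ⨆ l : {l : Fin n // inner ℝ α (x i) ≤ inner ℝ α (x l)},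
      slabMean x y α (inner ℝ α (x k)) (inner ℝ α (x l)) t

/-- `(F, α)` is a least squares estimate for the data `(x i, y i)`: it minimises the criterion over
all candidate pairs, and `F` is an extension of the isotonic distributional regression from
(observed index values) × `supp Q` that satisfies the shape constraints (`mem_class`). -/
structure IsEstimate {d n : ℕ} (𝒳 : Set (Cov d)) (Q : Measure ℝ) (x : Fin n → Cov d)
    (y : Fin n → ℝ) (F : ℝ → ℝ → ℝ) (α : Cov d) : Prop where
  norm_index : ‖α‖ = 1
  mem_class : MemClass 𝒳 α F
  minimal : ∀ (G : ℝ → ℝ → ℝ) (β : Cov d), ‖β‖ = 1 → MemClass 𝒳 β G →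
    criterion Q x y F α ≤ criterion Q x y G β
  fit : ∀ i : Fin n, ∀ t ∈ Q.support, F (inner ℝ α (x i)) t = isotonicFit x y α i t

/-- The bundled squared `L²` error `∫∫ (F₀(α₀ᵀx, t) - F(αᵀx, t))² dPX(x) dQ(t)`. -/
def bundledError {d : ℕ} (PX : Measure (Cov d)) (Q : Measure ℝ) (F₀ : ℝ → ℝ → ℝ) (α₀ : Cov d)
    (F : ℝ → ℝ → ℝ) (α : Cov d) : ENNReal :=
  ∫⁻ t, ∫⁻ x, ENNReal.ofReal ((F₀ (inner ℝ α₀ x) t - F (inner ℝ α x) t) ^ 2) ∂PX ∂Q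

end DSIM

end

/-!
Consistency of the index needs only the bundled error. Let `β ≠ α₀` be a unit vector. Since
`F₀(·, t)` is non-constant and continuous at the ends of its interval, it decreases strictly across
some interior index value `c = α₀ᵀx₀` with `x₀` in the interior of `𝒳`
(`DSIM.exists_decrease_point`). Moving from `x₀` along `β - α₀` lowers the `α₀`-index and raises the
`β`-index. So, for `α` near `β`, a function of `αᵀx` that is non-increasing in the index and the
function `F₀(α₀ᵀx, t)` are ordered in opposite ways on two open sets, and the former must miss the
latter by a fixed amount on a set of positive mass. The two open sets depend on `t` only through two
rational levels, hence one choice serves a set of thresholds of positive `Q`-measure, and the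
bundled error is bounded away from zero near `β` (`DSIM.exists_pos_le_bundledError`). By
compactness of the sphere the indices converge to `α₀` whenever the bundled error vanishes.

Consistency of the distribution functions is then read off the min-max formula, for each
`t ∈ supp Q` separately. For `u < v` let `H(u)` be the probability of `α₀ᵀX ∈ [u, v), Y ≤ t` minus
`c` times that of `α₀ᵀX ∈ [u, v)`. If `z < v` and `c < F₀(v, t)`, the model makes `H(u)` positive,
uniformly over `u` below a fixed `v' < v`. The empirical version of `H` along the fitted index
converges uniformly (`DSIM.Typical.eventually_contrast`): as `α̂ₙ → α₀` and `𝒳` is bounded, the event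
`α̂ₙᵀx < u` is sandwiched between events `α₀ᵀx < r` with `r` rational, which obey the law of large
numbers, and the limit is continuous as `α₀ᵀX` has no atoms. Hence all slabs that end at `v` have
means at least `c`, and so has the isotonic fit at any observation with index in `[z, v')`; as the
fit is non-increasing in the index, `F̂ₙ(z, t) ≥ c`. Slabs that begin at a fixed `v < z` give the
upper bound.

Both arguments work path by path along the subsequences supplied by the hypothesis on the bundled
error, which yields convergence in probability.
-/

namespace DSIM

variable {d : ℕ}

/-! ### The law of the covariates -/

/-- `ν` lives on the interior of `𝒳` and charges every nonempty open subset of `𝒳`. This is all that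
is needed of the lower density bounds. -/
structure Spread (𝒳 : Set (Cov d)) (ν : Measure (Cov d)) : Prop where
  pos : ∀ U : Set (Cov d), IsOpen U → U.Nonempty → U ⊆ 𝒳 → 0 < ν U
  null : ν (interior 𝒳)ᶜ = 0

lemma HasDensityBetween.spread {𝒳 : Set (Cov d)} (hconv : Convex ℝ 𝒳) {ν : Measure (Cov d)}
    {lo hi : ℝ} (hlo : 0 < lo) (h : HasDensityBetween ν 𝒳 lo hi) : Spread 𝒳 ν := by
  obtain ⟨p, -, hp, rfl⟩ := h
  constructor
  · intro U hU hne hsub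
    rw [withDensity_apply _ hU.measurableSet, Measure.restrict_restrict hU.measurableSet,
      Set.inter_eq_left.2 hsub]
    calc 0 < ENNReal.ofReal lo * volume U :=
          ENNReal.mul_pos (by simpa using hlo) (hU.measure_pos volume hne).ne'
      _ = ∫⁻ _ in U, ENNReal.ofReal lo := by rw [setLIntegral_const]
      _ ≤ ∫⁻ x in U, ENNReal.ofReal (p x) :=
          setLIntegral_mono' hU.measurableSet
            fun x hx => ENNReal.ofReal_le_ofReal (hp x (hsub hx)).1
  · refine withDensity_absolutelyContinuous _ _ ?_
    rw [Measure.restrict_apply isOpen_interior.measurableSet.compl]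
    refine measure_mono_null (fun x hx => ?_) (hconv.addHaar_frontier volume)
    exact ⟨subset_closure hx.2, hx.1⟩

/-- A mixture of spread laws is spread: the law of `X` is a mixture of its conditional laws given
`Y`. -/
lemma spread_fst_of_condKernel {𝒳 : Set (Cov d)} {P : Measure (Cov d × ℝ)} [IsProbabilityMeasure P]
    (h : ∀ᵐ y ∂P.snd, Spread 𝒳 ((P.map Prod.swap).condKernel y)) : Spread 𝒳 P.fst := by
  have hmix : ∀ A : Set (Cov d), MeasurableSet A →
      P.fst A = ∫⁻ y, (P.map Prod.swap).condKernel y A ∂P.snd := by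
    intro A hA
    have h1 := (P.map Prod.swap).disintegrate (P.map Prod.swap).condKernel
    rw [← Measure.snd_map_swap (ρ := P), Measure.snd_apply hA, ← Set.univ_prod]
    conv_lhs => rw [← h1]
    rw [Measure.compProd_apply_prod MeasurableSet.univ hA, Measure.fst_map_swap,
      Measure.restrict_univ]
  constructor
  · intro U hU hne hsub
    rw [hmix U hU.measurableSet, lintegral_pos_iff_support
      (Kernel.measurable_coe _ hU.measurableSet)]
    have : Function.support (fun y => (P.map Prod.swap).condKernel y U) ∈ ae P.snd := by
      filter_upwards [h] with y hy using (hy.pos U hU hne hsub).ne'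
    refine pos_iff_ne_zero.2 fun h0 => ?_
    have h1 := measure_eq_zero_iff_ae_notMem.1 h0
    have h2 : ∀ᵐ y ∂P.snd, False := by
      filter_upwards [this, h1] with y a b using b a
    exact IsProbabilityMeasure.ne_zero P.snd (by simpa using h2)
  · rw [hmix _ isOpen_interior.measurableSet.compl]
    exact (lintegral_congr_ae (by filter_upwards [h] with y hy using hy.null)).trans (by simp)

lemma Spread.of_weight {𝒳 : Set (Cov d)} (hconv : Convex ℝ 𝒳) {P : Measure (Cov d × ℝ)}
    [IsProbabilityMeasure P] {Q : Measure ℝ}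
    (hweight : DiscreteWeight 𝒳 P Q ∨ ContinuousWeight 𝒳 P Q) : Spread 𝒳 P.fst := by
  rcases hweight with ⟨⟨lo, hi, hlo, h⟩, -⟩ | ⟨⟨lo, hi, hlo, h⟩, -⟩
  · exact h.spread hconv hlo
  · exact spread_fst_of_condKernel (h.mono fun y hy => hy.spread hconv hlo)

lemma Spread.interior_nonempty {𝒳 : Set (Cov d)} {ν : Measure (Cov d)} [IsProbabilityMeasure ν]
    (h : Spread 𝒳 ν) : (interior 𝒳).Nonempty := by
  by_contra hne
  have := h.null
  rw [Set.not_nonempty_iff_eq_empty.1 hne] at this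
  simp at this

/-! ### Index intervals -/

lemma measurable_index (α : Cov d) : Measurable fun x : Cov d => inner ℝ α x := by fun_prop

lemma mem_indexSet {𝒳 : Set (Cov d)} (α : Cov d) {x : Cov d} (hx : x ∈ 𝒳) :
    inner ℝ α x ∈ indexSet 𝒳 α := ⟨x, hx, rfl⟩

lemma ordConnected_indexSet {𝒳 : Set (Cov d)} (hconv : Convex ℝ 𝒳) (α : Cov d) :
    (indexSet 𝒳 α).OrdConnected :=
  (hconv.linear_image (innerₛₗ ℝ α)).ordConnected

lemma exists_interior_index_mem {𝒳 : Set (Cov d)} (hconv : Convex ℝ 𝒳)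
    (hne : (interior 𝒳).Nonempty) {α : Cov d} {V : Set ℝ} (hV : IsOpen V)
    (h : (V ∩ indexSet 𝒳 α).Nonempty) : ∃ x ∈ interior 𝒳, inner ℝ α x ∈ V := by
  obtain ⟨-, hz, x, hx, rfl⟩ := h
  have hx' : x ∈ closure (interior 𝒳) := by
    rw [hconv.closure_interior_eq_closure_of_nonempty_interior hne]; exact subset_closure hx
  have hopen : IsOpen ((fun x : Cov d => inner ℝ α x) ⁻¹' V) := hV.preimage (by fun_prop)
  obtain ⟨y, hy, hy'⟩ := mem_closure_iff.1 hx' _ hopen hz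
  exact ⟨y, hy', hy⟩

lemma abs_inner_sub_inner_le {𝒳 : Set (Cov d)} {R : ℝ} (hR : ∀ x ∈ 𝒳, ‖x‖ ≤ R) {x : Cov d}
    (hx : x ∈ 𝒳) (α β : Cov d) : |inner ℝ α x - inner ℝ β x| ≤ ‖α - β‖ * R := by
  rw [← inner_sub_left]
  exact (abs_real_inner_le_norm _ _).trans
    (mul_le_mul_of_nonneg_left (hR x hx) (norm_nonneg _))

/-! ### Points of decrease -/

/-- A non-constant antitone function on an interval strictly decreases across some point `c`:
otherwise it would be locally constant. (At an end point of the interval the claim is empty; the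
intervals of interest are open.) -/
lemma exists_decrease_point {s : Set ℝ} (hs : s.OrdConnected) {f : ℝ → ℝ}
    (hf : AntitoneOn f s) (hne : ∃ z ∈ s, ∃ z' ∈ s, f z ≠ f z') :
    ∃ c ∈ s, ∀ w₁ ∈ s, ∀ w₂ ∈ s, w₁ < c → c < w₂ → f w₂ < f w₁ := by
  by_contra! hcon
  obtain ⟨z, hz, z', hz', hzz⟩ := hne
  refine hzz (hs.isPreconnected.induction₂' (fun x y => f x = f y) (fun c hc => ?_)
    (fun x y w _ _ _ h1 h2 => h1.trans h2) hz hz')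
  obtain ⟨w₁, h1, w₂, h2, h1c, hc2, hle⟩ := hcon c hc
  have hconst : ∀ y ∈ s, w₁ < y → y < w₂ → f y = f w₁ := fun y hy hy1 hy2 =>
    le_antisymm (hf h1 hy hy1.le) (hle.trans (hf hy h2 hy2.le))
  have hev : ∀ᶠ y in 𝓝[s] c, w₁ < y ∧ y < w₂ ∧ y ∈ s := by
    filter_upwards [mem_nhdsWithin_of_mem_nhds (Ioo_mem_nhds h1c hc2), self_mem_nhdsWithin]
      with y hy hys using ⟨hy.1, hy.2, hys⟩
  filter_upwards [hev] with y ⟨hy1, hy2, hys⟩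
  have := hconst c hc h1c hc2
  have := hconst y hys hy1 hy2
  constructor <;> simp_all

/-- Boundary continuity moves non-constancy from `C_α` into the index interval of the interior of
`𝒳`. -/
lemma exists_ne_on_interior {𝒳 : Set (Cov d)} (hconv : Convex ℝ 𝒳) (hint : (interior 𝒳).Nonempty)
    {α : Cov d} {f : ℝ → ℝ}
    (hne : ∃ z ∈ indexSet 𝒳 α, ∃ z' ∈ indexSet 𝒳 α, f z ≠ f z')
    (hf : AntitoneOn f (indexSet 𝒳 α))
    (hbd : ∀ z ∈ indexSet 𝒳 α ∩ frontier (indexSet 𝒳 α), ContinuousWithinAt f (indexSet 𝒳 α) z) :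
    ∃ z ∈ indexSet (interior 𝒳) α, ∃ z' ∈ indexSet (interior 𝒳) α, f z ≠ f z' := by
  by_contra! hcon
  have hsub : indexSet (interior 𝒳) α ⊆ indexSet 𝒳 α := Set.image_mono interior_subset
  obtain ⟨x₀, hx₀⟩ := hint
  have hk : ∀ z ∈ indexSet 𝒳 α, f z = f (inner ℝ α x₀) := by
    intro z hz
    by_cases hzi : z ∈ interior (indexSet 𝒳 α)
    · obtain ⟨ε, hε, hball⟩ := Metric.mem_nhds_iff.1 (mem_interior_iff_mem_nhds.1 hzi)
      have hmem : ∀ w, |w - z| < ε → w ∈ indexSet 𝒳 α := fun w hw => hball (by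
        rwa [Metric.mem_ball, Real.dist_eq])
      obtain ⟨x₁, hx₁, h1⟩ := exists_interior_index_mem hconv ⟨x₀, hx₀⟩ (α := α)
        (isOpen_Ioo (a := z - ε) (b := z)) ⟨z - ε / 2, ⟨by linarith, by linarith⟩,
          hmem _ (by rw [abs_lt]; constructor <;> linarith)⟩
      obtain ⟨x₂, hx₂, h2⟩ := exists_interior_index_mem hconv ⟨x₀, hx₀⟩ (α := α)
        (isOpen_Ioo (a := z) (b := z + ε)) ⟨z + ε / 2, ⟨by linarith, by linarith⟩,
          hmem _ (by rw [abs_lt]; constructor <;> linarith)⟩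
      have e1 := hcon _ (mem_indexSet α hx₁) _ (mem_indexSet α hx₀)
      have e2 := hcon _ (mem_indexSet α hx₂) _ (mem_indexSet α hx₀)
      have l1 := hf (hsub (mem_indexSet α hx₁)) hz h1.2.le
      have l2 := hf hz (hsub (mem_indexSet α hx₂)) h2.1.le
      linarith
    · have hcont := hbd z ⟨hz, subset_closure hz, hzi⟩
      have hcl : z ∈ closure (indexSet (interior 𝒳) α) := by
        refine mem_closure_iff.2 fun V hV hzV => ?_
        obtain ⟨x, hx, hxV⟩ := exists_interior_index_mem hconv ⟨x₀, hx₀⟩ hV ⟨z, hzV, hz⟩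
        exact ⟨_, hxV, mem_indexSet α hx⟩
      have : (𝓝[indexSet (interior 𝒳) α] z).NeBot := mem_closure_iff_nhdsWithin_neBot.1 hcl
      refine tendsto_nhds_unique (hcont.mono hsub) ?_
      refine tendsto_const_nhds.congr' ?_
      filter_upwards [self_mem_nhdsWithin] with w hw
      exact (hcon _ hw _ (mem_indexSet α hx₀)).symm
  obtain ⟨z, hz, z', hz', h⟩ := hne
  exact h ((hk z hz).trans (hk z' hz').symm)

/-! ### Consistency of the index -/

lemma measurable_section {𝒳 : Set (Cov d)} {α : Cov d} {F : ℝ → ℝ → ℝ} (hF : MemClass 𝒳 α F)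
    {z : ℝ} (hz : z ∈ indexSet 𝒳 α) : Measurable (F z) := (hF.cdf z hz).mono.measurable

/-- Suppose that `w₁ < w₂` separate the `α₀`-indices of two points of the interior of `𝒳` whose
`β`-indices are in the opposite order. Near these points a function of `αᵀx`, non-increasing in the
index with `α` close to `β`, must deviate from `F₀(α₀ᵀx, t)` by at least half of
`F₀(w₁, t) - F₀(w₂, t)`, on a set whose mass is bounded below. -/
lemma exists_le_bundledError {𝒳 : Set (Cov d)} (hconv : Convex ℝ 𝒳)
    (hbdd : Bornology.IsBounded 𝒳) {PX : Measure (Cov d)}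
    (hPX : Spread 𝒳 PX) (Q : Measure ℝ) {F₀ : ℝ → ℝ → ℝ} {α₀ : Cov d} (hF₀ : MemClass 𝒳 α₀ F₀)
    {β : Cov d} {w₁ w₂ : ℝ} (hw : w₁ < w₂) {x x' : Cov d} (hx : x ∈ interior 𝒳)
    (hx' : x' ∈ interior 𝒳) (hx'w : inner ℝ α₀ x' < w₁) (hwx : w₂ < inner ℝ α₀ x)
    (hβ : inner ℝ β x < inner ℝ β x') :
    ∃ m : ENNReal, 0 < m ∧ ∃ δ > 0, ∀ α : Cov d, ‖α - β‖ < δ → ∀ F, MemClass 𝒳 α F →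
      ∫⁻ t, ENNReal.ofReal (((F₀ w₁ t - F₀ w₂ t) / 2) ^ 2) * m ∂Q ≤
        bundledError PX Q F₀ α₀ F α := by
  obtain ⟨R₀, hR₀⟩ := hbdd.exists_norm_le
  set R : ℝ := max R₀ 1
  have hR : ∀ x ∈ 𝒳, ‖x‖ ≤ R := fun x hx => (hR₀ x hx).trans (le_max_left _ _)
  have hRpos : 0 < R := lt_of_lt_of_le one_pos (le_max_right _ _)
  set η : ℝ := (inner ℝ β x' - inner ℝ β x) / 4 with hη
  have hηpos : 0 < η := by rw [hη]; linarith
  have hO : ∀ (γ : Cov d) (V : Set ℝ), IsOpen V →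
      IsOpen ((fun y : Cov d => inner ℝ γ y) ⁻¹' V) := fun γ V hV => hV.preimage (by fun_prop)
  set U : Set (Cov d) := interior 𝒳 ∩ ((fun y => inner ℝ α₀ y) ⁻¹' Set.Ioi w₂ ∩
    (fun y => inner ℝ β y) ⁻¹' Set.Iio (inner ℝ β x + η)) with hU
  set U' : Set (Cov d) := interior 𝒳 ∩ ((fun y => inner ℝ α₀ y) ⁻¹' Set.Iio w₁ ∩
    (fun y => inner ℝ β y) ⁻¹' Set.Ioi (inner ℝ β x' - η)) with hU'
  have hUo : IsOpen U := isOpen_interior.inter ((hO _ _ isOpen_Ioi).inter (hO _ _ isOpen_Iio))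
  have hUo' : IsOpen U' := isOpen_interior.inter ((hO _ _ isOpen_Iio).inter (hO _ _ isOpen_Ioi))
  have hsub : U ⊆ 𝒳 := fun y hy => interior_subset hy.1
  have hsub' : U' ⊆ 𝒳 := fun y hy => interior_subset hy.1
  have hUpos : 0 < PX U := hPX.pos U hUo ⟨x, hx, hwx, by simp [hηpos]⟩ hsub
  have hUpos' : 0 < PX U' := hPX.pos U' hUo' ⟨x', hx', hx'w, by simp [hηpos]⟩ hsub'
  have hC := ordConnected_indexSet hconv α₀
  have hw₁ : w₁ ∈ indexSet 𝒳 α₀ := hC.out (mem_indexSet α₀ (interior_subset hx'))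
    (mem_indexSet α₀ (interior_subset hx)) ⟨hx'w.le, by linarith⟩
  have hw₂ : w₂ ∈ indexSet 𝒳 α₀ := hC.out (mem_indexSet α₀ (interior_subset hx'))
    (mem_indexSet α₀ (interior_subset hx)) ⟨by linarith, hwx.le⟩
  refine ⟨min (PX U) (PX U'), lt_min hUpos hUpos', η / R, div_pos hηpos hRpos,
    fun α hα F hF => ?_⟩
  have hαR : ‖α - β‖ * R < η := (lt_div_iff₀ hRpos).1 hα
  -- `α` inherits the order of the two neighbourhoods from `β`
  have hord : ∀ y ∈ U, ∀ y' ∈ U', inner ℝ α y ≤ inner ℝ α y' := by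
    intro y hy y' hy'
    have h1 := abs_le.1 (abs_inner_sub_inner_le hR (hsub hy) α β)
    have h2 := abs_le.1 (abs_inner_sub_inner_le hR (hsub' hy') α β)
    have h3 : inner ℝ β y < inner ℝ β x + η := hy.2.2
    have h4 : inner ℝ β x' - η < inner ℝ β y' := hy'.2.2
    linarith [h1.2, h2.1]
  refine lintegral_mono fun t => ?_
  set D : ℝ := (F₀ w₁ t - F₀ w₂ t) / 2 with hD
  have hDpos : 0 ≤ D := by have := hF₀.anti t hw₁ hw₂ hw.le; simp only at this; linarith
  -- a deviation by `D` throughout an open set bounds the inner integral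
  have key : ∀ V : Set (Cov d), IsOpen V →
      (∀ y ∈ V, D ≤ |F₀ (inner ℝ α₀ y) t - F (inner ℝ α y) t|) →
      ENNReal.ofReal (D ^ 2) * PX V ≤
        ∫⁻ y, ENNReal.ofReal ((F₀ (inner ℝ α₀ y) t - F (inner ℝ α y) t) ^ 2) ∂PX := by
    intro V hV h
    rw [← setLIntegral_const]
    refine (setLIntegral_mono' hV.measurableSet fun y hy => ?_).trans
      (setLIntegral_le_lintegral V _)
    refine ENNReal.ofReal_le_ofReal ?_
    rw [← sq_abs (F₀ _ _ - _)]
    exact pow_le_pow_left₀ hDpos (h y hy) 2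
  by_cases hcase : ∀ y ∈ U, (F₀ w₁ t + F₀ w₂ t) / 2 ≤ F (inner ℝ α y) t
  · refine (mul_le_mul_right (min_le_left _ _) _).trans (key U hUo fun y hy => ?_)
    have h1 := hF₀.anti t hw₂ (mem_indexSet α₀ (hsub hy)) (le_of_lt hy.2.1)
    have h2 := hcase y hy
    simp only at h1
    rw [abs_sub_comm]
    exact le_trans (by linarith) (le_abs_self _)
  · push Not at hcase
    obtain ⟨y, hy, hyF⟩ := hcase
    refine (mul_le_mul_right (min_le_right _ _) _).trans (key U' hUo' fun y' hy' => ?_)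
    have h1 := hF₀.anti t (mem_indexSet α₀ (hsub' hy')) hw₁ (le_of_lt hy'.2.1)
    have h2 := hF.anti t (mem_indexSet α (hsub hy)) (mem_indexSet α (hsub' hy')) (hord y hy y' hy')
    simp only at h1 h2
    exact le_trans (by linarith) (le_abs_self _)

/-- For `β ≠ α₀` and each `t` in the support of `Q`, moving from a point of decrease of `F₀(·, t)`
along `β - α₀` lowers the `α₀`-index and raises the `β`-index. The levels are rational, so that
there are countably many of them. -/
lemma exists_rat_separating {𝒳 : Set (Cov d)} (hconv : Convex ℝ 𝒳) (hint : (interior 𝒳).Nonempty)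
    {α₀ β : Cov d} (hα₀ : ‖α₀‖ = 1) (hβ : ‖β‖ = 1) (hne : β ≠ α₀) {f : ℝ → ℝ}
    (hf : AntitoneOn f (indexSet 𝒳 α₀))
    (hnonconst : ∃ z ∈ indexSet 𝒳 α₀, ∃ z' ∈ indexSet 𝒳 α₀, f z ≠ f z')
    (hbd : ∀ z ∈ indexSet 𝒳 α₀ ∩ frontier (indexSet 𝒳 α₀),
      ContinuousWithinAt f (indexSet 𝒳 α₀) z) :
    ∃ w₁ w₂ : ℚ, w₁ < w₂ ∧ f w₂ < f w₁ ∧ ∃ x ∈ interior 𝒳, ∃ x' ∈ interior 𝒳,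
      inner ℝ α₀ x' < w₁ ∧ w₂ < inner ℝ α₀ x ∧ inner ℝ β x < inner ℝ β x' := by
  have hC' := ordConnected_indexSet hconv.interior α₀
  obtain ⟨c, ⟨x₀, hx₀, rfl⟩, hdec⟩ := exists_decrease_point hC'
    (hf.mono (Set.image_mono interior_subset))
    (exists_ne_on_interior hconv hint hnonconst hf hbd)
  simp only at hdec
  have hlt : inner ℝ β α₀ < (1 : ℝ) := inner_lt_one_iff_real_of_norm_eq_one hβ hα₀ |>.2 hne
  set v : Cov d := β - α₀
  have hv₀ : inner ℝ α₀ v < 0 := by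
    rw [inner_sub_right, real_inner_self_eq_norm_sq, hα₀, real_inner_comm]; linarith
  have hvβ : 0 < inner ℝ β v := by
    rw [inner_sub_right, real_inner_self_eq_norm_sq, hβ]; linarith
  have hnear : ∀ᶠ s : ℝ in 𝓝 0, x₀ + s • v ∈ interior 𝒳 ∧ x₀ - s • v ∈ interior 𝒳 := by
    have h1 : Tendsto (fun s : ℝ => x₀ + s • v) (𝓝 0) (𝓝 x₀) := by
      have : Continuous fun s : ℝ => x₀ + s • v := by fun_prop
      simpa using this.tendsto 0
    have h2 : Tendsto (fun s : ℝ => x₀ - s • v) (𝓝 0) (𝓝 x₀) := by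
      have : Continuous fun s : ℝ => x₀ - s • v := by fun_prop
      simpa using this.tendsto 0
    exact (h1.eventually (isOpen_interior.mem_nhds hx₀)).and
      (h2.eventually (isOpen_interior.mem_nhds hx₀))
  obtain ⟨s, ⟨hs₁, hs₂⟩, hs⟩ :=
    ((hnear.filter_mono nhdsWithin_le_nhds).and (self_mem_nhdsWithin (s := Set.Ioi (0 : ℝ)))).exists
  have hs : 0 < s := hs
  have e1 : inner ℝ α₀ (x₀ + s • v) < inner ℝ α₀ x₀ := by
    rw [inner_add_right, inner_smul_right]; nlinarith
  have e2 : inner ℝ α₀ x₀ < inner ℝ α₀ (x₀ - s • v) := by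
    rw [inner_sub_right, inner_smul_right]; nlinarith
  have e3 : inner ℝ β (x₀ - s • v) < inner ℝ β (x₀ + s • v) := by
    rw [inner_sub_right, inner_add_right, inner_smul_right]; nlinarith
  obtain ⟨w₁, h1, h1'⟩ := exists_rat_btwn e1
  obtain ⟨w₂, h2, h2'⟩ := exists_rat_btwn e2
  have hm₁ := mem_indexSet α₀ hs₁
  have hm₂ := mem_indexSet α₀ hs₂
  refine ⟨w₁, w₂, by exact_mod_cast h1'.trans h2, ?_, _, hs₂, _, hs₁, h1, h2', e3⟩
  exact hdec _ (hC'.out hm₁ hm₂ ⟨h1.le, by linarith⟩) _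
    (hC'.out hm₁ hm₂ ⟨by linarith, h2'.le⟩) h1' h2

/-- The bundled error is bounded away from zero for indices near any `β ≠ α₀`. -/
lemma exists_pos_le_bundledError {𝒳 : Set (Cov d)} (hconv : Convex ℝ 𝒳)
    (hbdd : Bornology.IsBounded 𝒳) {PX : Measure (Cov d)} (hint : (interior 𝒳).Nonempty)
    (hPX : Spread 𝒳 PX) {Q : Measure ℝ} (hQ : Q ≠ 0) {F₀ : ℝ → ℝ → ℝ} {α₀ : Cov d}
    (hα₀ : ‖α₀‖ = 1) (hF₀ : MemClass 𝒳 α₀ F₀)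
    (hnonconst : ∀ t ∈ Q.support, ∃ z ∈ indexSet 𝒳 α₀, ∃ z' ∈ indexSet 𝒳 α₀, F₀ z t ≠ F₀ z' t)
    (hboundary : ∀ t ∈ Q.support, ∀ z ∈ indexSet 𝒳 α₀ ∩ frontier (indexSet 𝒳 α₀),
      ContinuousWithinAt (fun z' => F₀ z' t) (indexSet 𝒳 α₀) z)
    {β : Cov d} (hβ : ‖β‖ = 1) (hne : β ≠ α₀) :
    ∃ ε : ENNReal, 0 < ε ∧ ∃ δ > 0, ∀ α : Cov d, ‖α - β‖ < δ → ∀ F, MemClass 𝒳 α F →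
      ε ≤ bundledError PX Q F₀ α₀ F α := by
  -- some single pair of rational levels works for a set of thresholds of positive `Q`-measure
  obtain ⟨w, hwQ⟩ : ∃ w : ℚ × ℚ, 0 < Q {t | w.1 < w.2 ∧ F₀ w.2 t < F₀ w.1 t ∧
      ∃ x ∈ interior 𝒳, ∃ x' ∈ interior 𝒳, inner ℝ α₀ x' < w.1 ∧ w.2 < inner ℝ α₀ x ∧
        inner ℝ β x < inner ℝ β x'} := by
    by_contra! hcon
    have h0 := measure_iUnion_null fun w => nonpos_iff_eq_zero.1 (hcon w)
    have hcov : Q.support ⊆ ⋃ w : ℚ × ℚ, {t | w.1 < w.2 ∧ F₀ w.2 t < F₀ w.1 t ∧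
      ∃ x ∈ interior 𝒳, ∃ x' ∈ interior 𝒳, inner ℝ α₀ x' < w.1 ∧ w.2 < inner ℝ α₀ x ∧
        inner ℝ β x < inner ℝ β x'} := by
      intro t ht
      obtain ⟨w₁, w₂, h⟩ := exists_rat_separating hconv hint hα₀ hβ hne (hF₀.anti t)
        (hnonconst t ht) (hboundary t ht)
      exact Set.mem_iUnion.2 ⟨(w₁, w₂), h⟩
    have h1 := measure_mono_null hcov h0
    have h2 := Q.measure_compl_support
    refine hQ (Measure.measure_univ_eq_zero.1 ?_)
    rw [← Set.union_compl_self Q.support]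
    exact measure_union_null h1 h2
  obtain ⟨t₀, ht₀⟩ := nonempty_of_measure_ne_zero hwQ.ne'
  obtain ⟨hw, -, x, hx, x', hx', hx'w, hwx, hβx⟩ := ht₀
  have hw : (w.1 : ℝ) < w.2 := by exact_mod_cast hw
  obtain ⟨m, hm, δ, hδ, hle⟩ := exists_le_bundledError hconv hbdd hPX Q hF₀ hw hx hx' hx'w hwx hβx
  refine ⟨_, ?_, δ, hδ, hle⟩
  have hC := ordConnected_indexSet hconv α₀
  have hw₁ : (w.1 : ℝ) ∈ indexSet 𝒳 α₀ := hC.out (mem_indexSet α₀ (interior_subset hx'))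
    (mem_indexSet α₀ (interior_subset hx)) ⟨hx'w.le, by linarith⟩
  have hw₂ : (w.2 : ℝ) ∈ indexSet 𝒳 α₀ := hC.out (mem_indexSet α₀ (interior_subset hx'))
    (mem_indexSet α₀ (interior_subset hx)) ⟨by linarith, hwx.le⟩
  have hmeas₁ := measurable_section hF₀ hw₁
  have hmeas₂ := measurable_section hF₀ hw₂
  rw [lintegral_pos_iff_support (by fun_prop)]
  refine hwQ.trans_le (measure_mono fun t ht => ?_)
  have h2 := ht.2.1
  have : 0 < ((F₀ w.1 t - F₀ w.2 t) / 2) ^ 2 := by have := sub_pos.2 h2; positivity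
  exact (ENNReal.mul_pos (ENNReal.ofReal_pos.2 this).ne' hm.ne').ne'

/-- If the bundled error vanishes, then the index is consistent: by compactness of the sphere it is
enough that no `β ≠ α₀` is a cluster point. -/
theorem tendsto_index_of_bundledError {𝒳 : Set (Cov d)} (hconv : Convex ℝ 𝒳)
    (hbdd : Bornology.IsBounded 𝒳) {PX : Measure (Cov d)} (hint : (interior 𝒳).Nonempty)
    (hPX : Spread 𝒳 PX) {Q : Measure ℝ} (hQ : Q ≠ 0) {F₀ : ℝ → ℝ → ℝ} {α₀ : Cov d}
    (hα₀ : ‖α₀‖ = 1) (hF₀ : MemClass 𝒳 α₀ F₀)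
    (hnonconst : ∀ t ∈ Q.support, ∃ z ∈ indexSet 𝒳 α₀, ∃ z' ∈ indexSet 𝒳 α₀, F₀ z t ≠ F₀ z' t)
    (hboundary : ∀ t ∈ Q.support, ∀ z ∈ indexSet 𝒳 α₀ ∩ frontier (indexSet 𝒳 α₀),
      ContinuousWithinAt (fun z' => F₀ z' t) (indexSet 𝒳 α₀) z)
    {α : ℕ → Cov d} {F : ℕ → ℝ → ℝ → ℝ} (hα : ∀ l, ‖α l‖ = 1) (hF : ∀ l, MemClass 𝒳 (α l) (F l))
    (herr : Tendsto (fun l => bundledError PX Q F₀ α₀ (F l) (α l)) atTop (𝓝 0)) :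
    Tendsto α atTop (𝓝 α₀) := by
  refine (isCompact_sphere (0 : Cov d) 1).tendsto_nhds_of_unique_mapClusterPt
    (Eventually.of_forall fun l => by simpa using hα l) fun β hβ hcl => ?_
  by_contra hne
  obtain ⟨ε, hε, δ, hδ, hle⟩ := exists_pos_le_bundledError hconv hbdd hint hPX hQ hα₀ hF₀ hnonconst
    hboundary (by simpa using hβ) hne
  have hfreq : ∃ᶠ l in atTop, α l ∈ Metric.ball β δ :=
    hcl.frequently (Metric.ball_mem_nhds β hδ)
  obtain ⟨l, hl, hlt⟩ := (hfreq.and_eventually (herr.eventually_lt_const hε)).exists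
  exact (hle (α l) (by simpa [dist_eq_norm] using hl) (F l) (hF l)).not_gt hlt

/-! ### Empirical frequencies -/

open Classical in
/-- The proportion of `w 0, …, w (n - 1)` that lie in `S` (zero for `n = 0`). -/
noncomputable def empFreq {E : Type*} (w : ℕ → E) (n : ℕ) (S : Set E) : ℝ :=
  (((Finset.range n).filter fun i => w i ∈ S).card : ℝ) / n

lemma empFreq_mono {E : Type*} (w : ℕ → E) (n : ℕ) {S T : Set E}
    (h : ∀ i < n, w i ∈ S → w i ∈ T) : empFreq w n S ≤ empFreq w n T := by
  classical
  unfold empFreq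
  refine div_le_div_of_nonneg_right (Nat.cast_le.2 (Finset.card_le_card fun i hi => ?_))
    (Nat.cast_nonneg n)
  rw [Finset.mem_filter] at hi ⊢
  exact ⟨hi.1, h i (Finset.mem_range.1 hi.1) hi.2⟩

lemma empFreq_nonneg {E : Type*} (w : ℕ → E) (n : ℕ) (S : Set E) : 0 ≤ empFreq w n S := by
  unfold empFreq; positivity

lemma exists_mem_of_empFreq_pos {E : Type*} {w : ℕ → E} {n : ℕ} {S : Set E}
    (h : 0 < empFreq w n S) : ∃ i : Fin n, w i ∈ S := by
  classical
  by_contra! hcon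
  refine h.ne' ?_
  unfold empFreq
  rw [Finset.card_eq_zero.2 (Finset.filter_eq_empty_iff.2 fun i hi => hcon ⟨i, by simpa using hi⟩)]
  simp

lemma empFreq_union {E : Type*} (w : ℕ → E) (n : ℕ) {S T : Set E} (h : Disjoint S T) :
    empFreq w n (S ∪ T) = empFreq w n S + empFreq w n T := by
  classical
  unfold empFreq
  rw [← add_div, ← Nat.cast_add, ← Finset.card_union_of_disjoint, ← Finset.filter_or]
  · simp only [Set.mem_union]
  · exact Finset.disjoint_filter.2 fun i _ h1 h2 => Set.disjoint_left.1 h h1 h2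

lemma natCard_fin_eq_empFreq {E : Type*} (w : ℕ → E) {n : ℕ} (hn : n ≠ 0) (S : Set E) :
    (Nat.card {s : Fin n // w s ∈ S} : ℝ) = n * empFreq w n S := by
  classical
  have hn' : (n : ℝ) ≠ 0 := by exact_mod_cast hn
  unfold empFreq
  rw [mul_div_cancel₀ _ hn', Nat.card_eq_fintype_card, Fintype.card_subtype, Nat.cast_inj]
  refine Finset.card_bij (fun i _ => (i : ℕ)) ?_ ?_ ?_
  · intro i hi; simpa using hi
  · intro i _ j _ h; exact Fin.ext h
  · intro j hj
    simp only [Finset.mem_filter, Finset.mem_range] at hj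
    exact ⟨⟨j, hj.1⟩, by simpa using hj.2, rfl⟩

/-- The strong law of large numbers for the frequency of an event. -/
lemma tendsto_empFreq {Ω E : Type*} [MeasurableSpace Ω] [MeasurableSpace E] {μ : Measure Ω}
    [IsProbabilityMeasure μ] {P : Measure E} {W : ℕ → Ω → E} (hlaw : ∀ i, HasLaw (W i) P μ)
    (hindep : iIndepFun W μ) {S : Set E} (hS : MeasurableSet S) :
    ∀ᵐ ω ∂μ, Tendsto (fun n => empFreq (fun i => W i ω) n S) atTop (𝓝 (P.real S)) := by
  classical
  have hmeas : Measurable (S.indicator (fun _ => (1 : ℝ))) := measurable_const.indicator hS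
  have hint : Integrable (fun ω => S.indicator (fun _ => (1 : ℝ)) (W 0 ω)) μ := by
    refine Integrable.of_bound (C := 1)
      (hmeas.comp_aemeasurable (hlaw 0).aemeasurable).aestronglyMeasurable
      (Eventually.of_forall fun ω => ?_)
    by_cases h : W 0 ω ∈ S <;> simp [h]
  have hslln := strong_law_ae_real (μ := μ) (fun i ω => S.indicator (fun _ => (1 : ℝ)) (W i ω)) hint
    (fun i j hij => (hindep.indepFun hij).comp hmeas hmeas)
    (fun i => ((hlaw i).identDistrib (hlaw 0)).comp hmeas)
  have hexp : ∫ ω, S.indicator (fun _ => (1 : ℝ)) (W 0 ω) ∂μ = P.real S := by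
    rw [← (hlaw 0).map_eq, ← integral_map (hlaw 0).aemeasurable
      hmeas.aestronglyMeasurable, integral_indicator_const _ hS]
    simp
  rw [hexp] at hslln
  filter_upwards [hslln] with ω hω
  refine hω.congr fun n => ?_
  simp [empFreq, Set.indicator_apply]

/-- The observations `(x, y)` with `αᵀx < u` and `y ∈ A`. -/
def below (α : Cov d) (u : ℝ) (A : Set ℝ) : Set (Cov d × ℝ) :=
  {p | inner ℝ α p.1 < u ∧ p.2 ∈ A}

lemma measurableSet_below (α : Cov d) (u : ℝ) {A : Set ℝ} (hA : MeasurableSet A) :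
    MeasurableSet (below α u A) :=
  ((measurable_index α).comp measurable_fst measurableSet_Iio).inter (measurable_snd hA)

lemma below_mono (α : Cov d) {u v : ℝ} (h : u ≤ v) (A : Set ℝ) : below α u A ⊆ below α v A :=
  fun _ hp => ⟨hp.1.trans_le h, hp.2⟩

/-- If the law of `αᵀX` is atomless, then `u ↦ P(αᵀX < u, Y ∈ A)` is continuous. -/
lemma continuous_measure_below {P : Measure (Cov d × ℝ)} [IsProbabilityMeasure P] {α : Cov d}
    (hno : ∀ u : ℝ, P.fst {x | inner ℝ α x = u} = 0) {A : Set ℝ} (hA : MeasurableSet A) :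
    Continuous fun u => P.real (below α u A) := by
  have hnull : ∀ u : ℝ, ∀ᵐ p ∂P, inner ℝ α p.1 ≠ u := by
    intro u
    have := hno u
    rw [Measure.fst_apply (s := {x | inner ℝ α x = u})
      ((measurable_index α) (measurableSet_singleton u))] at this
    simpa [ae_iff] using this
  have h : (fun u => P.real (below α u A)) =
      fun u => ∫ p, (below α u A).indicator (fun _ => (1 : ℝ)) p ∂P := by
    ext u
    rw [integral_indicator_const _ (measurableSet_below α u hA)]; simp
  rw [h, continuous_iff_continuousAt]
  intro u
  refine continuousAt_of_dominated (bound := fun _ => 1) ?_ ?_ (integrable_const _) ?_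
  · exact Eventually.of_forall fun v =>
      (measurable_const.indicator (measurableSet_below α v hA)).aestronglyMeasurable
  · exact Eventually.of_forall fun v => Eventually.of_forall fun p => by
      by_cases hp : p ∈ below α v A <;> simp [hp]
  · filter_upwards [hnull u] with p hp
    have hcongr : ∀ᶠ v in 𝓝 u, (below α v A).indicator (fun _ => (1 : ℝ)) p =
        (below α u A).indicator (fun _ => (1 : ℝ)) p := by
      have hiff : ∀ᶠ v in 𝓝 u, inner ℝ α p.1 < v ↔ inner ℝ α p.1 < u := by
        rcases lt_or_gt_of_ne hp with h | h
        · filter_upwards [lt_mem_nhds h] with v hv using iff_of_true hv h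
        · filter_upwards [gt_mem_nhds h] with v hv using iff_of_false hv.not_gt h.not_gt
      filter_upwards [hiff] with v hv
      classical
      simp only [Set.indicator_apply, below, Set.mem_ofPred_eq, hv]
    exact (tendsto_const_nhds.congr' (hcongr.mono fun _ h => h.symm))

/-- Empirical frequencies along estimated indices converge uniformly on compact sets. The functions
`g l` interpolate between the frequencies of `αᵀx < u` and of `αᵀx ≤ u`, so that both are covered;
they are sandwiched between frequencies along `α₀` at nearby rational points. -/
lemma eventually_abs_sub_lt_of_sandwich {P : Measure (Cov d × ℝ)} [IsProbabilityMeasure P]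
    {α₀ : Cov d} (hno : ∀ u : ℝ, P.fst {x | inner ℝ α₀ x = u} = 0) {A : Set ℝ}
    (hA : MeasurableSet A) {w : ℕ → Cov d × ℝ} {R : ℝ} (hR : ∀ i, ‖(w i).1‖ ≤ R)
    (hlln : ∀ r : ℚ, Tendsto (fun n => empFreq w n (below α₀ r A)) atTop
      (𝓝 (P.real (below α₀ r A))))
    {N : ℕ → ℕ} (hN : Tendsto N atTop atTop) {α : ℕ → Cov d} (hα : Tendsto α atTop (𝓝 α₀))
    {g : ℕ → ℝ → ℝ} (hg : ∀ l u, empFreq w (N l) (below (α l) u A) ≤ g l u)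
    (hg' : ∀ l u v, u < v → g l u ≤ empFreq w (N l) (below (α l) v A))
    {K : Set ℝ} (hK : IsCompact K) {e : ℝ} (he : 0 < e) :
    ∀ᶠ l in atTop, ∀ u ∈ K, |g l u - P.real (below α₀ u A)| < e := by
  have hcont := continuous_measure_below hno hA
  have hunif : TendstoUniformlyOn g (fun u => P.real (below α₀ u A)) atTop K := by
    rw [← tendstoLocallyUniformlyOn_iff_tendstoUniformlyOn_of_compact hK,
      Metric.tendstoLocallyUniformlyOn_iff]
    intro e he u _
    obtain ⟨h, hh, hball⟩ := Metric.continuousAt_iff.1 (hcont.continuousAt (x := u)) (e / 4)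
      (by positivity)
    obtain ⟨r₁, hr₁, hr₁'⟩ := exists_rat_btwn (show u - h < u - h / 2 by linarith)
    obtain ⟨r₂, hr₂, hr₂'⟩ := exists_rat_btwn (show u + h / 2 < u + h by linarith)
    refine ⟨Metric.ball u (h / 4), mem_nhdsWithin_of_mem_nhds
      (Metric.ball_mem_nhds u (by positivity)), ?_⟩
    have hsmall : ∀ᶠ l in atTop, ‖α l - α₀‖ * R < h / 8 := by
      have h0 : Tendsto (fun l => ‖α l - α₀‖ * R) atTop (𝓝 0) := by
        simpa using (tendsto_iff_norm_sub_tendsto_zero.1 hα).mul_const R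
      exact h0.eventually_lt_const (by positivity)
    have hl₁ := (Metric.tendsto_nhds.1 ((hlln r₁).comp hN)) (e / 4) (by positivity)
    have hl₂ := (Metric.tendsto_nhds.1 ((hlln r₂).comp hN)) (e / 4) (by positivity)
    filter_upwards [hsmall, hl₁, hl₂] with l hl h1 h2 v hv
    simp only [Function.comp_apply, Real.dist_eq, Metric.mem_ball, abs_lt] at h1 h2 hv
    have hidx : ∀ i, |inner ℝ (α l) (w i).1 - inner ℝ α₀ (w i).1| < h / 8 := fun i =>
      (abs_inner_sub_inner_le (𝒳 := Set.range fun i => (w i).1) (R := R)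
        (by rintro _ ⟨j, rfl⟩; exact hR j) ⟨i, rfl⟩ _ _).trans_lt hl
    have k1 : empFreq w (N l) (below α₀ r₁ A) ≤ g l v := by
      refine le_trans (empFreq_mono w _ fun i _ hi => And.intro ?_ hi.2) (hg l v)
      have := (abs_lt.1 (hidx i)).2
      have := hi.1
      linarith
    have k2 : g l v ≤ empFreq w (N l) (below α₀ r₂ A) := by
      refine (hg' l v (v + h / 8) (by linarith)).trans
        (empFreq_mono w _ fun i _ hi => ⟨?_, hi.2⟩)
      have := (abs_lt.1 (hidx i)).1
      have := hi.1
      linarith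
    have d1 := hball (x := r₁) (by rw [Real.dist_eq, abs_lt]; constructor <;> linarith)
    have d2 := hball (x := r₂) (by rw [Real.dist_eq, abs_lt]; constructor <;> linarith)
    have d3 := hball (x := v) (by rw [Real.dist_eq, abs_lt]; constructor <;> linarith)
    rw [Real.dist_eq, abs_lt] at d1 d2 d3 ⊢
    constructor <;> linarith
  filter_upwards [Metric.tendstoUniformlyOn_iff.1 hunif e he] with l hl u hu
  rw [abs_sub_comm]
  exact hl u hu

/-! ### Slabs -/

/-- The observations `(x, y)` with `αᵀx ∈ I` and `y ∈ A`. -/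
def slab (α : Cov d) (I A : Set ℝ) : Set (Cov d × ℝ) :=
  {p | inner ℝ α p.1 ∈ I ∧ p.2 ∈ A}

lemma measurableSet_slab (α : Cov d) {I A : Set ℝ} (hI : MeasurableSet I) (hA : MeasurableSet A) :
    MeasurableSet (slab α I A) :=
  ((measurable_index α).comp measurable_fst hI).inter (measurable_snd hA)

lemma below_union_slab (α : Cov d) {u v : ℝ} (h : u ≤ v) (A : Set ℝ) :
    below α u A ∪ slab α (Set.Ico u v) A = below α v A := by
  ext p
  constructor
  · rintro (hp | hp)
    · exact below_mono α h A hp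
    · exact ⟨hp.1.2, hp.2⟩
  · intro hp
    rcases lt_or_ge (inner ℝ α p.1) u with hlt | hge
    · exact Or.inl ⟨hlt, hp.2⟩
    · exact Or.inr ⟨⟨hge, hp.1⟩, hp.2⟩

lemma below_union_slab_Icc (α : Cov d) {u v : ℝ} (h : u ≤ v) (A : Set ℝ) :
    below α u A ∪ slab α (Set.Icc u v) A = slab α (Set.Iic v) A := by
  ext p
  constructor
  · rintro (hp | hp)
    · exact ⟨hp.1.le.trans h, hp.2⟩
    · exact ⟨hp.1.2, hp.2⟩
  · intro hp
    rcases lt_or_ge (inner ℝ α p.1) u with hlt | hge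
    · exact Or.inl ⟨hlt, hp.2⟩
    · exact Or.inr ⟨⟨hge, hp.1⟩, hp.2⟩

lemma disjoint_below_slab (α : Cov d) {u : ℝ} {I : Set ℝ} (h : I ⊆ Set.Ici u) (A : Set ℝ) :
    Disjoint (below α u A) (slab α I A) :=
  Set.disjoint_left.2 fun _ hp hp' => (h hp'.1).not_gt hp.1

lemma empFreq_below_add_slab (w : ℕ → Cov d × ℝ) (n : ℕ) (α : Cov d) {u v : ℝ} (h : u ≤ v)
    (A : Set ℝ) : empFreq w n (below α u A) + empFreq w n (slab α (Set.Ico u v) A) =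
      empFreq w n (below α v A) := by
  rw [← empFreq_union w n (disjoint_below_slab α Set.Ico_subset_Ici_self A), below_union_slab α h]

lemma empFreq_below_add_slab_Icc (w : ℕ → Cov d × ℝ) (n : ℕ) (α : Cov d) {u v : ℝ} (h : u ≤ v)
    (A : Set ℝ) : empFreq w n (below α u A) + empFreq w n (slab α (Set.Icc u v) A) =
      empFreq w n (slab α (Set.Iic v) A) := by
  rw [← empFreq_union w n (disjoint_below_slab α Set.Icc_subset_Ici_self A),
    below_union_slab_Icc α h]

lemma measureReal_below_add_slab (P : Measure (Cov d × ℝ)) [IsProbabilityMeasure P] (α : Cov d)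
    {u v : ℝ} (h : u ≤ v) {A : Set ℝ} (hA : MeasurableSet A) :
    P.real (below α u A) + P.real (slab α (Set.Ico u v) A) = P.real (below α v A) := by
  rw [← measureReal_union (disjoint_below_slab α Set.Ico_subset_Ici_self A)
    (measurableSet_slab α measurableSet_Ico hA), below_union_slab α h]

/-! ### Conditional probabilities of slabs -/

lemma measure_slab_Iic {P : Measure (Cov d × ℝ)} [IsProbabilityMeasure P] {𝒳 : Set (Cov d)}
    {F₀ : ℝ → ℝ → ℝ} {α₀ : Cov d} (hmodel : IsModel 𝒳 P F₀ α₀) {I : Set ℝ} (hI : MeasurableSet I)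
    (t : ℝ) : P (slab α₀ I (Set.Iic t)) =
      ∫⁻ x in (fun x => inner ℝ α₀ x) ⁻¹' I, ENNReal.ofReal (F₀ (inner ℝ α₀ x) t) ∂P.fst := by
  have h1 := P.disintegrate P.condKernel
  have h2 : slab α₀ I (Set.Iic t) = ((fun x => inner ℝ α₀ x) ⁻¹' I) ×ˢ Set.Iic t := rfl
  rw [h2]
  conv_lhs => rw [← h1]
  rw [Measure.compProd_apply_prod (measurable_index α₀ hI) measurableSet_Iic]
  refine lintegral_congr_ae (ae_restrict_of_ae ?_)
  filter_upwards [hmodel.cond] with x hx using hx t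

lemma measure_slab_univ (P : Measure (Cov d × ℝ)) (α : Cov d) {I : Set ℝ} (hI : MeasurableSet I) :
    P (slab α I Set.univ) = P.fst ((fun x => inner ℝ α x) ⁻¹' I) := by
  rw [Measure.fst_apply (measurable_index α hI)]
  congr 1
  ext p
  simp [slab]

lemma ae_mem_of_spread {𝒳 : Set (Cov d)} {ν : Measure (Cov d)} (h : Spread 𝒳 ν) :
    ∀ᵐ x ∂ν, x ∈ 𝒳 := by
  filter_upwards [measure_eq_zero_iff_ae_notMem.1 h.null] with x hx
  exact interior_subset (Set.notMem_compl_iff.1 hx)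

lemma mul_measureReal_slab_le {P : Measure (Cov d × ℝ)} [IsProbabilityMeasure P] {𝒳 : Set (Cov d)}
    {F₀ : ℝ → ℝ → ℝ} {α₀ : Cov d} (hmodel : IsModel 𝒳 P F₀ α₀) (hspread : Spread 𝒳 P.fst)
    {I : Set ℝ} (hI : MeasurableSet I) {t c : ℝ}
    (hc : ∀ u ∈ I ∩ indexSet 𝒳 α₀, c ≤ F₀ u t) :
    c * P.real (slab α₀ I Set.univ) ≤ P.real (slab α₀ I (Set.Iic t)) := by
  have h : ENNReal.ofReal c * P (slab α₀ I Set.univ) ≤ P (slab α₀ I (Set.Iic t)) := by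
    rw [measure_slab_Iic hmodel hI, measure_slab_univ P α₀ hI, ← setLIntegral_const]
    refine lintegral_mono_ae ?_
    filter_upwards [ae_restrict_of_ae (ae_mem_of_spread hspread),
      ae_restrict_mem (measurable_index α₀ hI)] with x hx hxI
    exact ENNReal.ofReal_le_ofReal (hc _ ⟨hxI, mem_indexSet α₀ hx⟩)
  have h' := ENNReal.toReal_mono (measure_ne_top P _) h
  rw [ENNReal.toReal_mul] at h'
  refine le_trans ?_ h'
  rw [ENNReal.toReal_ofReal']
  exact mul_le_mul_of_nonneg_right (le_max_left c 0) ENNReal.toReal_nonneg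

lemma measureReal_slab_le_mul {P : Measure (Cov d × ℝ)} [IsProbabilityMeasure P] {𝒳 : Set (Cov d)}
    {F₀ : ℝ → ℝ → ℝ} {α₀ : Cov d} (hmodel : IsModel 𝒳 P F₀ α₀) (hspread : Spread 𝒳 P.fst)
    {I : Set ℝ} (hI : MeasurableSet I) {t c : ℝ} (hc₀ : 0 ≤ c)
    (hc : ∀ u ∈ I ∩ indexSet 𝒳 α₀, F₀ u t ≤ c) :
    P.real (slab α₀ I (Set.Iic t)) ≤ c * P.real (slab α₀ I Set.univ) := by
  have h : P (slab α₀ I (Set.Iic t)) ≤ ENNReal.ofReal c * P (slab α₀ I Set.univ) := by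
    rw [measure_slab_Iic hmodel hI, measure_slab_univ P α₀ hI, ← setLIntegral_const]
    refine lintegral_mono_ae ?_
    filter_upwards [ae_restrict_of_ae (ae_mem_of_spread hspread),
      ae_restrict_mem (measurable_index α₀ hI)] with x hx hxI
    exact ENNReal.ofReal_le_ofReal (hc _ ⟨hxI, mem_indexSet α₀ hx⟩)
  have h' := ENNReal.toReal_mono (by finiteness) h
  rwa [ENNReal.toReal_mul, ENNReal.toReal_ofReal hc₀] at h'

lemma measureReal_slab_pos {P : Measure (Cov d × ℝ)} [IsProbabilityMeasure P] {𝒳 : Set (Cov d)}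
    (hconv : Convex ℝ 𝒳) (hspread : Spread 𝒳 P.fst) {α : Cov d} {u v : ℝ} (huv : u < v)
    (hu : u ∈ indexSet 𝒳 α) (hv : v ∈ indexSet 𝒳 α) :
    0 < P.real (slab α (Set.Ico u v) Set.univ) := by
  obtain ⟨x, hx, hxI⟩ := exists_interior_index_mem hconv hspread.interior_nonempty (α := α)
    (isOpen_Ioo (a := u) (b := v)) ⟨(u + v) / 2, ⟨by linarith, by linarith⟩,
      (ordConnected_indexSet hconv α).out hu hv ⟨by linarith, by linarith⟩⟩
  have hopen : IsOpen (interior 𝒳 ∩ (fun x => inner ℝ α x) ⁻¹' Set.Ioo u v) :=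
    isOpen_interior.inter (isOpen_Ioo.preimage (by fun_prop))
  have hpos := hspread.pos _ hopen ⟨x, hx, hxI⟩ (fun y hy => interior_subset hy.1)
  refine ENNReal.toReal_pos ?_ (measure_ne_top P _)
  rw [measure_slab_univ P α measurableSet_Ico]
  exact (hpos.trans_le (measure_mono fun y hy => And.intro hy.2.1.le hy.2.2)).ne'

/-! ### Bounds on the isotonic fit -/

lemma slabMean_eq (w : ℕ → Cov d × ℝ) {n : ℕ} (hn : n ≠ 0) (α : Cov d) (u v t : ℝ) :
    slabMean (fun i : Fin n => (w i).1) (fun i : Fin n => (w i).2) α u v t =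
      empFreq w n (slab α (Set.Icc u v) (Set.Iic t)) /
        empFreq w n (slab α (Set.Icc u v) Set.univ) := by
  have hn' : (n : ℝ) ≠ 0 := by exact_mod_cast hn
  have h1 := natCard_fin_eq_empFreq w hn (slab α (Set.Icc u v) (Set.Iic t))
  have h2 := natCard_fin_eq_empFreq w hn (slab α (Set.Icc u v) Set.univ)
  have h3 : Nat.card {s : Fin n // inner ℝ α (w s).1 ∈ Set.Icc u v} =
      Nat.card {s : Fin n // w s ∈ slab α (Set.Icc u v) Set.univ} :=
    Nat.card_congr (Equiv.subtypeEquivRight fun s => by simp [slab])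
  rw [← mul_div_mul_left _ _ hn', ← h1, ← h2, ← h3]
  rfl

lemma empFreq_slab_le (w : ℕ → Cov d × ℝ) (n : ℕ) (α : Cov d) (I A : Set ℝ) :
    empFreq w n (slab α I A) ≤ empFreq w n (slab α I Set.univ) :=
  empFreq_mono w n fun _ _ h => ⟨h.1, trivial⟩

/-- A lower bound for the means over slabs with the fixed right end `v`, beyond the index of
observation `i`, is a lower bound for the isotonic fit: the maximum over `l` is at least the
mean for the last observation before `v`. -/
lemma le_isotonicFit (w : ℕ → Cov d × ℝ) {n : ℕ} (α : Cov d) (i : Fin n) {t c v : ℝ}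
    (hi : inner ℝ α (w i).1 < v)
    (h : ∀ k : Fin n, inner ℝ α (w k).1 ≤ inner ℝ α (w i).1 →
      c * empFreq w n (slab α (Set.Ico (inner ℝ α (w k).1) v) Set.univ) <
        empFreq w n (slab α (Set.Ico (inner ℝ α (w k).1) v) (Set.Iic t))) :
    c ≤ isotonicFit (fun i : Fin n => (w i).1) (fun i : Fin n => (w i).2) α i t := by
  classical
  have hn : n ≠ 0 := by rintro rfl; exact i.elim0
  obtain ⟨l, hl, hmax⟩ := Finset.exists_max_image
    (Finset.univ.filter fun l : Fin n => inner ℝ α (w l).1 < v)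
    (fun l : Fin n => inner ℝ α (w l).1) ⟨i, by simpa using hi⟩
  have hlv : inner ℝ α (w l).1 < v := by simpa using hl
  have hmax' : ∀ s < n, inner ℝ α (w s).1 < v → inner ℝ α (w s).1 ≤ inner ℝ α (w l).1 :=
    fun s hs hsv => hmax ⟨s, hs⟩ (by simpa using hsv)
  have : Nonempty {k : Fin n // inner ℝ α (w k).1 ≤ inner ℝ α (w i).1} := ⟨i, le_rfl⟩
  refine le_ciInf fun k => ?_
  refine le_trans ?_ (le_ciSup (Set.finite_range _).bddAbove ⟨l, hmax' i i.2 hi⟩)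
  rw [slabMean_eq w hn]
  have hsub : ∀ A, empFreq w n (slab α (Set.Ico (inner ℝ α (w k.1).1) v) A) =
      empFreq w n (slab α (Set.Icc (inner ℝ α (w k.1).1) (inner ℝ α (w l).1)) A) := fun A =>
    le_antisymm (empFreq_mono w n fun s hs hp => ⟨⟨hp.1.1, hmax' s hs hp.1.2⟩, hp.2⟩)
      (empFreq_mono w n fun s _ hp => ⟨⟨hp.1.1, hp.1.2.trans_lt hlv⟩, hp.2⟩)
  have hk := h k.1 k.2
  rw [hsub, hsub] at hk
  have hle := empFreq_slab_le w n α (Set.Icc (inner ℝ α (w k.1).1) (inner ℝ α (w l).1)) (Set.Iic t)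
  have h0 := empFreq_nonneg w n
    (slab α (Set.Icc (inner ℝ α (w k.1).1) (inner ℝ α (w l).1)) (Set.Iic t))
  rcases (h0.trans hle).eq_or_lt with hb | hb
  · rw [← hb] at hk hle; linarith
  · exact (le_div_iff₀ hb).2 hk.le

/-- The counterpart of `le_isotonicFit`, with slabs whose left end `v` is fixed. -/
lemma isotonicFit_le (w : ℕ → Cov d × ℝ) {n : ℕ} (α : Cov d) (i : Fin n) {t c v : ℝ}
    (hi : v ≤ inner ℝ α (w i).1)
    (h : ∀ l : Fin n, inner ℝ α (w i).1 ≤ inner ℝ α (w l).1 →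
      empFreq w n (slab α (Set.Icc v (inner ℝ α (w l).1)) (Set.Iic t)) <
        c * empFreq w n (slab α (Set.Icc v (inner ℝ α (w l).1)) Set.univ)) :
    isotonicFit (fun i : Fin n => (w i).1) (fun i : Fin n => (w i).2) α i t ≤ c := by
  classical
  have hn : n ≠ 0 := by rintro rfl; exact i.elim0
  obtain ⟨k, hk, hmin⟩ := Finset.exists_min_image
    (Finset.univ.filter fun l : Fin n => v ≤ inner ℝ α (w l).1)
    (fun l : Fin n => inner ℝ α (w l).1) ⟨i, by simpa using hi⟩
  have hkv : v ≤ inner ℝ α (w k).1 := by simpa using hk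
  have hmin' : ∀ s < n, v ≤ inner ℝ α (w s).1 → inner ℝ α (w k).1 ≤ inner ℝ α (w s).1 :=
    fun s hs hsv => hmin ⟨s, hs⟩ (by simpa using hsv)
  have : Nonempty {l : Fin n // inner ℝ α (w i).1 ≤ inner ℝ α (w l).1} := ⟨i, le_rfl⟩
  refine (ciInf_le (Set.finite_range _).bddBelow ⟨k, hmin' i i.2 hi⟩).trans ?_
  refine ciSup_le fun l => ?_
  rw [slabMean_eq w hn]
  have hsub : ∀ A, empFreq w n (slab α (Set.Icc v (inner ℝ α (w l.1).1)) A) =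
      empFreq w n (slab α (Set.Icc (inner ℝ α (w k).1) (inner ℝ α (w l.1).1)) A) := fun A =>
    le_antisymm (empFreq_mono w n fun s hs hp => ⟨⟨hmin' s hs hp.1.1, hp.1.2⟩, hp.2⟩)
      (empFreq_mono w n fun s _ hp => ⟨⟨hkv.trans hp.1.1, hp.1.2⟩, hp.2⟩)
  have hl := h l.1 l.2
  rw [hsub, hsub] at hl
  have h0 := empFreq_nonneg w n
    (slab α (Set.Icc (inner ℝ α (w k).1) (inner ℝ α (w l.1).1)) Set.univ)
  have h1 := empFreq_nonneg w n
    (slab α (Set.Icc (inner ℝ α (w k).1) (inner ℝ α (w l.1).1)) (Set.Iic t))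
  rcases h0.eq_or_lt with hb | hb
  · rw [← hb] at hl; linarith
  · exact (div_le_iff₀ hb).2 hl.le

/-! ### Consistency of the fitted distribution functions -/

/-- The data sequence `w` lies in `𝒳` and obeys the law of large numbers for the countably many
events `{α₀ᵀx < r}` and `{α₀ᵀx < r, y ≤ t}`, `r` rational. -/
structure Typical (𝒳 : Set (Cov d)) (P : Measure (Cov d × ℝ)) (α₀ : Cov d) (t : ℝ)
    (w : ℕ → Cov d × ℝ) : Prop where
  mem : ∀ i, (w i).1 ∈ 𝒳
  lln_univ : ∀ r : ℚ, Tendsto (fun n => empFreq w n (below α₀ r Set.univ)) atTop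
    (𝓝 (P.real (below α₀ r Set.univ)))
  lln_Iic : ∀ r : ℚ, Tendsto (fun n => empFreq w n (below α₀ r (Set.Iic t))) atTop
    (𝓝 (P.real (below α₀ r (Set.Iic t))))

/-- Uniform convergence, on compact sets and along estimated indices, of the weighted difference of
the two kinds of frequencies that decides whether a slab mean exceeds `c`. -/
lemma Typical.eventually_contrast {𝒳 : Set (Cov d)} {P : Measure (Cov d × ℝ)}
    [IsProbabilityMeasure P] {α₀ : Cov d} {t : ℝ} {w : ℕ → Cov d × ℝ} (hw : Typical 𝒳 P α₀ t w)
    {R : ℝ} (hR : ∀ x ∈ 𝒳, ‖x‖ ≤ R) (hno : ∀ u : ℝ, P.fst {x | inner ℝ α₀ x = u} = 0)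
    {N : ℕ → ℕ} (hN : Tendsto N atTop atTop) {α : ℕ → Cov d} (hα : Tendsto α atTop (𝓝 α₀))
    {S : ℕ → ℝ → Set ℝ → Set (Cov d × ℝ)} (hS : ∀ l u A, below (α l) u A ⊆ S l u A)
    (hS' : ∀ l u v A, u < v → S l u A ⊆ below (α l) v A)
    {K : Set ℝ} (hK : IsCompact K) (c : ℝ) {e : ℝ} (he : 0 < e) :
    ∀ᶠ l in atTop, ∀ u ∈ K,
      |(empFreq w (N l) (S l u (Set.Iic t)) - c * empFreq w (N l) (S l u Set.univ)) -
        (P.real (below α₀ u (Set.Iic t)) - c * P.real (below α₀ u Set.univ))| < e := by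
  have hR' : ∀ i, ‖(w i).1‖ ≤ R := fun i => hR _ (hw.mem i)
  have h1 := eventually_abs_sub_lt_of_sandwich hno measurableSet_Iic hR' hw.lln_Iic hN hα
    (g := fun l u => empFreq w (N l) (S l u (Set.Iic t)))
    (fun l u => empFreq_mono w _ fun i _ hi => hS l u _ hi)
    (fun l u v huv => empFreq_mono w _ fun i _ hi => hS' l u v _ huv hi) hK (half_pos he)
  have hc : 0 < |c| + 1 := by positivity
  have h2 := eventually_abs_sub_lt_of_sandwich hno MeasurableSet.univ hR' hw.lln_univ hN hα
    (g := fun l u => empFreq w (N l) (S l u Set.univ))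
    (fun l u => empFreq_mono w _ fun i _ hi => hS l u _ hi)
    (fun l u v huv => empFreq_mono w _ fun i _ hi => hS' l u v _ huv hi) hK
    (div_pos (half_pos he) hc)
  filter_upwards [h1, h2] with l hl1 hl2 u hu
  have k1 := hl1 u hu
  have k2 := hl2 u hu
  set a := empFreq w (N l) (S l u (Set.Iic t)) - P.real (below α₀ u (Set.Iic t))
  set b := empFreq w (N l) (S l u Set.univ) - P.real (below α₀ u Set.univ)
  have k3 : |c * b| ≤ e / 2 := by
    rw [abs_mul]
    rw [lt_div_iff₀ hc] at k2
    nlinarith [abs_nonneg c, abs_nonneg b]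
  calc _ = |a - c * b| := by congr 1; ring
    _ ≤ |a| + |c * b| := abs_sub _ _
    _ < e := by linarith

/-- Eventually there are observations with fitted index in a given interval. -/
lemma Typical.eventually_exists_index_mem {𝒳 : Set (Cov d)} {P : Measure (Cov d × ℝ)}
    [IsProbabilityMeasure P] {α₀ : Cov d} {t : ℝ} {w : ℕ → Cov d × ℝ} (hw : Typical 𝒳 P α₀ t w)
    {R : ℝ} (hR : ∀ x ∈ 𝒳, ‖x‖ ≤ R) (hno : ∀ u : ℝ, P.fst {x | inner ℝ α₀ x = u} = 0)
    {N : ℕ → ℕ} (hN : Tendsto N atTop atTop) {α : ℕ → Cov d} (hα : Tendsto α atTop (𝓝 α₀))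
    {u v : ℝ} (huv : u ≤ v) (hpos : 0 < P.real (slab α₀ (Set.Ico u v) Set.univ)) :
    ∀ᶠ l in atTop, ∃ i : Fin (N l), inner ℝ (α l) (w i).1 ∈ Set.Ico u v := by
  have h := eventually_abs_sub_lt_of_sandwich hno MeasurableSet.univ (fun i => hR _ (hw.mem i))
    hw.lln_univ hN hα (g := fun l u => empFreq w (N l) (below (α l) u Set.univ))
    (fun l u => le_rfl) (fun l u v huv => empFreq_mono w _ fun i _ hi => below_mono _ huv.le _ hi)
    (isCompact_Icc (a := u) (b := v)) (half_pos hpos)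
  filter_upwards [h] with l hl
  have h1 := abs_lt.1 (hl u ⟨le_rfl, huv⟩)
  have h2 := abs_lt.1 (hl v ⟨huv, le_rfl⟩)
  have h3 := empFreq_below_add_slab w (N l) (α l) huv Set.univ
  have h4 := measureReal_below_add_slab P α₀ huv MeasurableSet.univ
  obtain ⟨i, hi⟩ := exists_mem_of_empFreq_pos (w := w) (n := N l)
    (S := slab (α l) (Set.Ico u v) Set.univ) (by linarith [h1.2, h2.1])
  exact ⟨i, hi.1⟩

lemma eventually_mem_indexSet {𝒳 : Set (Cov d)} (hconv : Convex ℝ 𝒳) {α₀ : Cov d} {z : ℝ}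
    (hz : z ∈ interior (indexSet 𝒳 α₀)) {α : ℕ → Cov d} (hα : Tendsto α atTop (𝓝 α₀)) :
    ∀ᶠ l in atTop, z ∈ indexSet 𝒳 (α l) := by
  have hmem : ∀ᶠ u in 𝓝 z, u ∈ indexSet 𝒳 α₀ := mem_interior_iff_mem_nhds.1 hz
  obtain ⟨-, ⟨x₁, hx₁, rfl⟩, h1⟩ :=
    ((hmem.filter_mono nhdsWithin_le_nhds).and (self_mem_nhdsWithin (s := Set.Iio z))).exists
  obtain ⟨-, ⟨x₂, hx₂, rfl⟩, h2⟩ :=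
    ((hmem.filter_mono nhdsWithin_le_nhds).and (self_mem_nhdsWithin (s := Set.Ioi z))).exists
  have hlim : ∀ x, Tendsto (fun l => inner ℝ (α l) x) atTop (𝓝 (inner ℝ α₀ x)) :=
    fun x => hα.inner tendsto_const_nhds
  filter_upwards [(hlim x₁).eventually_lt_const h1, (hlim x₂).eventually_const_lt h2] with l l1 l2
  exact (ordConnected_indexSet hconv (α l)).out (mem_indexSet _ hx₁) (mem_indexSet _ hx₂)
    ⟨l1.le, l2.le⟩

/-- Lower half of pointwise consistency. Observations just above `z` have a fitted value at least
the smallest mean over slabs that end at a fixed `v > z`; these slabs have non-negligible mass, and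
there `F₀(·, t) ≥ F₀(v, t) > c`. -/
lemma Typical.eventually_le_fit {𝒳 : Set (Cov d)} (hconv : Convex ℝ 𝒳)
    {P : Measure (Cov d × ℝ)} [IsProbabilityMeasure P] (hspread : Spread 𝒳 P.fst)
    {F₀ : ℝ → ℝ → ℝ} {α₀ : Cov d} (hmodel : IsModel 𝒳 P F₀ α₀) {t : ℝ}
    {w : ℕ → Cov d × ℝ} (hw : Typical 𝒳 P α₀ t w)
    {R : ℝ} (hR : ∀ x ∈ 𝒳, ‖x‖ ≤ R) (hno : ∀ u : ℝ, P.fst {x | inner ℝ α₀ x = u} = 0)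
    {N : ℕ → ℕ} (hN : Tendsto N atTop atTop) {α : ℕ → Cov d} (hα : Tendsto α atTop (𝓝 α₀))
    (hα₁ : ∀ l, ‖α l‖ = 1) {F : ℕ → ℝ → ℝ → ℝ} (hF : ∀ l, MemClass 𝒳 (α l) (F l))
    (hfit : ∀ l, ∀ i : Fin (N l), F l (inner ℝ (α l) (w i).1) t =
      isotonicFit (fun i : Fin (N l) => (w i).1) (fun i : Fin (N l) => (w i).2) (α l) i t)
    {z : ℝ} (hz : z ∈ interior (indexSet 𝒳 α₀)) (hcont : ContinuousAt (fun u => F₀ u t) z)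
    {c : ℝ} (hc : c < F₀ z t) : ∀ᶠ l in atTop, c ≤ F l z t := by
  obtain ⟨v, ⟨hvc, hvC⟩, hzv⟩ := (((hcont.eventually_const_lt hc).and
    (mem_interior_iff_mem_nhds.1 hz)).filter_mono (nhdsWithin_le_nhds (s := Set.Ioi z)) |>.and
      self_mem_nhdsWithin).exists
  have hzv : z < v := hzv
  have hvC : v ∈ indexSet 𝒳 α₀ := hvC
  have hzC := interior_subset hz
  set v' := (z + v) / 2 with hv'
  have hv'C : v' ∈ indexSet 𝒳 α₀ :=
    (ordConnected_indexSet hconv α₀).out hzC hvC ⟨by linarith, by linarith⟩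
  have hM := measureReal_slab_pos hconv hspread (show v' < v by linarith) hv'C hvC
  set M := P.real (slab α₀ (Set.Ico v' v) Set.univ)
  set ε := F₀ v t - c with hε
  have hεpos : 0 < ε := sub_pos.2 hvc
  have e1 := hw.eventually_contrast hR hno hN hα (S := fun l => below (α l)) (fun l u A => le_rfl)
    (fun l u v A huv => below_mono _ huv.le A) (isCompact_Icc (a := min (-R) z) (b := v)) c
    (e := ε * M / 2) (by positivity)
  have e2 := hw.eventually_exists_index_mem hR hno hN hα (show z ≤ v' by linarith)
    (measureReal_slab_pos hconv hspread (show z < v' by linarith) hzC hv'C)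
  filter_upwards [e1, e2, eventually_mem_indexSet hconv hz hα] with l h1 ⟨i, hzi, hiv⟩ hzl
  have hFi := (hF l).anti t hzl (mem_indexSet (α l) (hw.mem i)) hzi
  simp only at hFi
  refine le_trans ?_ hFi
  rw [hfit l i]
  refine le_isotonicFit w (α l) i (v := v) (by linarith) fun k hk => ?_
  set u := inner ℝ (α l) (w k).1
  have huv' : u ≤ v' := hk.trans hiv.le
  have huv : u ≤ v := by linarith
  have huR : -R ≤ u := by
    have : |inner ℝ (α l) (w k).1| ≤ R := (abs_real_inner_le_norm _ _).trans
      (by rw [hα₁ l, one_mul]; exact hR _ (hw.mem k))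
    exact (abs_le.1 this).1
  have a1 := abs_lt.1 (h1 u ⟨(min_le_left _ _).trans huR, huv⟩)
  have a2 := abs_lt.1 (h1 v ⟨(min_le_right _ _).trans hzv.le, le_rfl⟩)
  have b1 := empFreq_below_add_slab w (N l) (α l) huv (Set.Iic t)
  have b2 := empFreq_below_add_slab w (N l) (α l) huv Set.univ
  have c1 := measureReal_below_add_slab P α₀ huv (measurableSet_Iic (a := t))
  have c2 := measureReal_below_add_slab P α₀ huv MeasurableSet.univ
  have hmodel' := mul_measureReal_slab_le hmodel hspread (measurableSet_Ico (a := u) (b := v))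
    (t := t) (c := F₀ v t) fun y hy => hmodel.mem_class.anti t hy.2 hvC hy.1.2.le
  have hmass : M ≤ P.real (slab α₀ (Set.Ico u v) Set.univ) :=
    measureReal_mono fun p hp => ⟨⟨huv'.trans hp.1.1, hp.1.2⟩, hp.2⟩
  have hεM := mul_le_mul_of_nonneg_left hmass hεpos.le
  rw [← b1, ← b2, ← c1, ← c2] at a2
  have hexp : ε * P.real (slab α₀ (Set.Ico u v) Set.univ) =
    F₀ v t * P.real (slab α₀ (Set.Ico u v) Set.univ) -
      c * P.real (slab α₀ (Set.Ico u v) Set.univ) := by rw [hε]; ring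
  linarith [a1.2, a2.1]

/-- Upper half of pointwise consistency; the slabs now begin at a fixed `v < z`. -/
lemma Typical.eventually_fit_le {𝒳 : Set (Cov d)} (hconv : Convex ℝ 𝒳)
    {P : Measure (Cov d × ℝ)} [IsProbabilityMeasure P] (hspread : Spread 𝒳 P.fst)
    {F₀ : ℝ → ℝ → ℝ} {α₀ : Cov d} (hmodel : IsModel 𝒳 P F₀ α₀) {t : ℝ}
    {w : ℕ → Cov d × ℝ} (hw : Typical 𝒳 P α₀ t w)
    {R : ℝ} (hR : ∀ x ∈ 𝒳, ‖x‖ ≤ R) (hno : ∀ u : ℝ, P.fst {x | inner ℝ α₀ x = u} = 0)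
    {N : ℕ → ℕ} (hN : Tendsto N atTop atTop) {α : ℕ → Cov d} (hα : Tendsto α atTop (𝓝 α₀))
    (hα₁ : ∀ l, ‖α l‖ = 1) {F : ℕ → ℝ → ℝ → ℝ} (hF : ∀ l, MemClass 𝒳 (α l) (F l))
    (hfit : ∀ l, ∀ i : Fin (N l), F l (inner ℝ (α l) (w i).1) t =
      isotonicFit (fun i : Fin (N l) => (w i).1) (fun i : Fin (N l) => (w i).2) (α l) i t)
    {z : ℝ} (hz : z ∈ interior (indexSet 𝒳 α₀)) (hcont : ContinuousAt (fun u => F₀ u t) z)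
    {c : ℝ} (hc : F₀ z t < c) : ∀ᶠ l in atTop, F l z t ≤ c := by
  obtain ⟨v, ⟨hvc, hvC⟩, hvz⟩ := (((hcont.eventually_lt_const hc).and
    (mem_interior_iff_mem_nhds.1 hz)).filter_mono (nhdsWithin_le_nhds (s := Set.Iio z)) |>.and
      self_mem_nhdsWithin).exists
  have hvz : v < z := hvz
  have hvC : v ∈ indexSet 𝒳 α₀ := hvC
  have hzC := interior_subset hz
  set v' := (v + z) / 2 with hv'
  have hv'C : v' ∈ indexSet 𝒳 α₀ :=
    (ordConnected_indexSet hconv α₀).out hvC hzC ⟨by linarith, by linarith⟩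
  have hM := measureReal_slab_pos hconv hspread (show v < v' by linarith) hvC hv'C
  set M := P.real (slab α₀ (Set.Ico v v') Set.univ)
  set ε := c - F₀ v t with hε
  have hεpos : 0 < ε := sub_pos.2 hvc
  have hK := isCompact_Icc (a := v) (b := max R z)
  have e1 := hw.eventually_contrast hR hno hN hα (S := fun l => below (α l)) (fun l u A => le_rfl)
    (fun l u v A huv => below_mono _ huv.le A) hK c (e := ε * M / 2) (by positivity)
  have e1' := hw.eventually_contrast hR hno hN hα (S := fun l u A => slab (α l) (Set.Iic u) A)
    (fun l u A p hp => ⟨hp.1.le, hp.2⟩) (fun l u v A huv p hp => ⟨lt_of_le_of_lt hp.1 huv, hp.2⟩)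
    hK c (e := ε * M / 2) (by positivity)
  have e2 := hw.eventually_exists_index_mem hR hno hN hα (show v' ≤ z by linarith)
    (measureReal_slab_pos hconv hspread (show v' < z by linarith) hv'C hzC)
  filter_upwards [e1, e1', e2, eventually_mem_indexSet hconv hz hα] with l h1 h1' ⟨i, hvi, hiz⟩ hzl
  have hFi := (hF l).anti t (mem_indexSet (α l) (hw.mem i)) hzl hiz.le
  simp only at hFi
  refine hFi.trans ?_
  rw [hfit l i]
  refine isotonicFit_le w (α l) i (v := v) (by linarith) fun k hk => ?_
  set u := inner ℝ (α l) (w k).1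
  have hv'u : v' ≤ u := hvi.trans hk
  have hvu : v ≤ u := by linarith
  have huR : u ≤ R := by
    have : |inner ℝ (α l) (w k).1| ≤ R := (abs_real_inner_le_norm _ _).trans
      (by rw [hα₁ l, one_mul]; exact hR _ (hw.mem k))
    exact (abs_le.1 this).2
  have a1 := abs_lt.1 (h1 v ⟨le_rfl, hvz.le.trans (le_max_right _ _)⟩)
  have a2 := abs_lt.1 (h1' u ⟨hvu, huR.trans (le_max_left _ _)⟩)
  have b1 := empFreq_below_add_slab_Icc w (N l) (α l) hvu (Set.Iic t)
  have b2 := empFreq_below_add_slab_Icc w (N l) (α l) hvu Set.univ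
  have c1 := measureReal_below_add_slab P α₀ hvu (measurableSet_Iic (a := t))
  have c2 := measureReal_below_add_slab P α₀ hvu MeasurableSet.univ
  have hF₀pos : 0 ≤ F₀ v t :=
    (hmodel.mem_class.cdf v hvC).mono.le_of_tendsto (hmodel.mem_class.cdf v hvC).tendsto_bot t
  have hmodel' := measureReal_slab_le_mul hmodel hspread (measurableSet_Ico (a := v) (b := u))
    (t := t) hF₀pos fun y hy => hmodel.mem_class.anti t hvC hy.2 hy.1.1
  have hmass : M ≤ P.real (slab α₀ (Set.Ico v u) Set.univ) :=
    measureReal_mono fun p hp => ⟨⟨hp.1.1, hp.1.2.trans_le hv'u⟩, hp.2⟩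
  have hεM := mul_le_mul_of_nonneg_left hmass hεpos.le
  rw [← b1, ← b2, ← c1, ← c2] at a2
  have hexp : ε * P.real (slab α₀ (Set.Ico v u) Set.univ) =
    c * P.real (slab α₀ (Set.Ico v u) Set.univ) -
      F₀ v t * P.real (slab α₀ (Set.Ico v u) Set.univ) := by rw [hε]; ring
  linarith [a1.1, a2.2]

lemma Typical.tendsto_fit {𝒳 : Set (Cov d)} (hconv : Convex ℝ 𝒳) (hbdd : Bornology.IsBounded 𝒳)
    {P : Measure (Cov d × ℝ)} [IsProbabilityMeasure P] (hspread : Spread 𝒳 P.fst)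
    {F₀ : ℝ → ℝ → ℝ} {α₀ : Cov d} (hmodel : IsModel 𝒳 P F₀ α₀) {t : ℝ}
    {w : ℕ → Cov d × ℝ} (hw : Typical 𝒳 P α₀ t w)
    (hno : ∀ u : ℝ, P.fst {x | inner ℝ α₀ x = u} = 0)
    {N : ℕ → ℕ} (hN : Tendsto N atTop atTop) {α : ℕ → Cov d} (hα : Tendsto α atTop (𝓝 α₀))
    {Q : Measure ℝ} (ht : t ∈ Q.support) {F : ℕ → ℝ → ℝ → ℝ}
    (hest : ∀ l, IsEstimate 𝒳 Q (fun i : Fin (N l) => (w i).1) (fun i : Fin (N l) => (w i).2)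
      (F l) (α l))
    {z : ℝ} (hz : z ∈ interior (indexSet 𝒳 α₀)) (hcont : ContinuousAt (fun u => F₀ u t) z) :
    Tendsto (fun l => F l z t) atTop (𝓝 (F₀ z t)) := by
  obtain ⟨R, hR⟩ := hbdd.exists_norm_le
  refine tendsto_order.2 ⟨fun c hc => ?_, fun c hc => ?_⟩
  · obtain ⟨c', h1, h2⟩ := exists_between hc
    filter_upwards [hw.eventually_le_fit hconv hspread hmodel hR hno hN hα
      (fun l => (hest l).norm_index) (fun l => (hest l).mem_class)
      (fun l i => (hest l).fit i t ht) hz hcont h2] with l hl using h1.trans_le hl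
  · obtain ⟨c', h1, h2⟩ := exists_between hc
    filter_upwards [hw.eventually_fit_le hconv hspread hmodel hR hno hN hα
      (fun l => (hest l).norm_index) (fun l => (hest l).mem_class)
      (fun l i => (hest l).fit i t ht) hz hcont h1] with l hl using hl.trans_lt h2

/-- Almost every data sequence is typical. -/
lemma ae_typical {𝒳 : Set (Cov d)} {P : Measure (Cov d × ℝ)} [IsProbabilityMeasure P]
    (hspread : Spread 𝒳 P.fst) (α₀ : Cov d) (t : ℝ)
    {Ω : Type*} [MeasurableSpace Ω] {μ : Measure Ω} [IsProbabilityMeasure μ]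
    {W : ℕ → Ω → Cov d × ℝ} (hlaw : ∀ i, HasLaw (W i) P μ) (hindep : iIndepFun W μ) :
    ∀ᵐ ω ∂μ, Typical 𝒳 P α₀ t fun i => W i ω := by
  have h1 : ∀ᵐ ω ∂μ, ∀ i, (W i ω).1 ∈ interior 𝒳 := by
    refine ae_all_iff.2 fun i => ?_
    have hmeas : MeasurableSet {p : Cov d × ℝ | p.1 ∈ interior 𝒳} :=
      measurable_fst isOpen_interior.measurableSet
    have hP : ∀ᵐ p ∂P, p.1 ∈ interior 𝒳 := by
      have := hspread.null
      rwa [Measure.fst_apply isOpen_interior.measurableSet.compl] at this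
    rw [← (hlaw i).map_eq] at hP
    exact ae_of_ae_map (hlaw i).aemeasurable hP
  have h2 := fun A (hA : MeasurableSet A) => ae_all_iff.2 fun r : ℚ =>
    tendsto_empFreq hlaw hindep (measurableSet_below α₀ r hA)
  filter_upwards [h1, h2 Set.univ MeasurableSet.univ, h2 (Set.Iic t) measurableSet_Iic]
    with ω k1 k2 k3
  exact ⟨fun i => interior_subset (k1 i), k2, k3⟩

lemma HasDensityBetween.measure_singleton {ν : Measure ℝ} {S : Set ℝ} {lo hi : ℝ}
    (h : HasDensityBetween ν S lo hi) (u : ℝ) : ν {u} = 0 := by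
  obtain ⟨p, -, -, rfl⟩ := h
  exact (withDensity_absolutelyContinuous _ _) (by simp)

end DSIM

theorem theorem2 {d : ℕ} (𝒳 : Set (DSIM.Cov d))
    (P : Measure (DSIM.Cov d × ℝ)) [IsProbabilityMeasure P]
    (Q : Measure ℝ) [IsFiniteMeasure Q] (hQ : Q ≠ 0)
    (F₀ : ℝ → ℝ → ℝ) (α₀ : DSIM.Cov d) (hmodel : DSIM.IsModel 𝒳 P F₀ α₀)
    -- the covariate space is bounded and convex
    (hbdd : Bornology.IsBounded 𝒳) (hconv : Convex ℝ 𝒳)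
    -- the two alternatives for the weighting measure and the law of the covariates
    (hweight : DSIM.DiscreteWeight 𝒳 P Q ∨ DSIM.ContinuousWeight 𝒳 P Q)
    -- all linear indices have a uniformly bounded density
    (hindex : ∃ q : ℝ, ∀ α : DSIM.Cov d, ‖α‖ = 1 →
      DSIM.HasDensityBetween (P.fst.map (fun x => inner ℝ α x)) Set.univ 0 q)
    -- left-continuity, non-constancy, and continuity at the boundary of the sections of `F₀`
    (hleft : ∀ t ∈ Q.support, ∀ z ∈ DSIM.indexSet 𝒳 α₀,
      ContinuousWithinAt (fun z' => F₀ z' t) (DSIM.indexSet 𝒳 α₀ ∩ Set.Iic z) z)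
    (hnonconst : ∀ t ∈ Q.support, ∃ z ∈ DSIM.indexSet 𝒳 α₀, ∃ z' ∈ DSIM.indexSet 𝒳 α₀,
      F₀ z t ≠ F₀ z' t)
    (hboundary : ∀ t ∈ Q.support, ∀ z ∈ DSIM.indexSet 𝒳 α₀ ∩ frontier (DSIM.indexSet 𝒳 α₀),
      ContinuousWithinAt (fun z' => F₀ z' t) (DSIM.indexSet 𝒳 α₀) z)
    -- an i.i.d. sample from `P`
    {Ω : Type*} [MeasurableSpace Ω] (μ : Measure Ω) [IsProbabilityMeasure μ]
    (X : ℕ → Ω → DSIM.Cov d) (Y : ℕ → Ω → ℝ)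
    (hlaw : ∀ i, HasLaw (fun ω => (X i ω, Y i ω)) P μ)
    (hindep : iIndepFun (fun (i : ℕ) (ω : Ω) => (X i ω, Y i ω)) μ)
    -- least squares estimates computed from the first `n` observations
    (Fhat : ℕ → Ω → ℝ → ℝ → ℝ) (αhat : ℕ → Ω → DSIM.Cov d)
    (hFmeas : ∀ n z t, AEMeasurable (fun ω => Fhat n ω z t) μ)
    (hαmeas : ∀ n, AEMeasurable (αhat n) μ)
    (hest : ∀ n, ∀ᵐ ω ∂μ, DSIM.IsEstimate 𝒳 Q (fun i : Fin n => X i ω) (fun i : Fin n => Y i ω)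
      (Fhat n ω) (αhat n ω))
    -- every subsequence has a further subsequence along which the bundled error vanishes a.s.
    (hsub : ∀ φ : ℕ → ℕ, StrictMono φ → ∃ ψ : ℕ → ℕ, StrictMono ψ ∧ ∀ᵐ ω ∂μ,
      Tendsto (fun l => DSIM.bundledError P.fst Q F₀ α₀ (Fhat (φ (ψ l)) ω) (αhat (φ (ψ l)) ω))
        atTop (𝓝 0)) :
    TendstoInMeasure μ αhat atTop (fun _ => α₀) ∧
    ∀ z ∈ interior (DSIM.indexSet 𝒳 α₀), ∀ t ∈ Q.support,
      ContinuousWithinAt (Function.uncurry F₀) (DSIM.indexSet 𝒳 α₀ ×ˢ Q.support) (z, t) →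
      TendstoInMeasure μ (fun n ω => Fhat n ω z t) atTop (fun _ => F₀ z t) := by
  have hspread := DSIM.Spread.of_weight hconv hweight
  have hno : ∀ u : ℝ, P.fst {x | inner ℝ α₀ x = u} = 0 := by
    intro u
    obtain ⟨q, hq⟩ := hindex
    have h := (hq α₀ hmodel.norm_index).measure_singleton u
    rwa [Measure.map_apply (DSIM.measurable_index α₀) (measurableSet_singleton u)] at h
  -- almost surely, the index converges along every sequence along which the bundled error vanishes
  have hindexlim : ∀ᵐ ω ∂μ, ∀ N : ℕ → ℕ,
      Tendsto (fun l => DSIM.bundledError P.fst Q F₀ α₀ (Fhat (N l) ω) (αhat (N l) ω))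
        atTop (𝓝 0) → Tendsto (fun l => αhat (N l) ω) atTop (𝓝 α₀) := by
    filter_upwards [ae_all_iff.2 hest] with ω hω N herr
    exact DSIM.tendsto_index_of_bundledError hconv hbdd hspread.interior_nonempty hspread hQ
      hmodel.norm_index hmodel.mem_class hnonconst hboundary (fun l => (hω (N l)).norm_index)
      (fun l => (hω (N l)).mem_class) herr
  constructor
  · refine (exists_seq_tendstoInMeasure_atTop_iff fun n => (hαmeas n).aestronglyMeasurable).2
      fun φ hφ => ?_
    obtain ⟨ψ, hψ, herr⟩ := hsub φ hφ
    refine ⟨ψ, hψ, ?_⟩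
    filter_upwards [hindexlim, herr] with ω hω hω'
    exact hω (fun l => φ (ψ l)) hω'
  · intro z hz t ht hcont
    have hcont' : ContinuousAt (fun u => F₀ u t) z := by
      have h1 : ContinuousWithinAt (fun u => F₀ u t) (DSIM.indexSet 𝒳 α₀) z :=
        hcont.comp (f := fun u => (u, t)) (by fun_prop) fun u hu => ⟨hu, ht⟩
      exact h1.continuousAt (mem_interior_iff_mem_nhds.1 hz)
    refine (exists_seq_tendstoInMeasure_atTop_iff fun n =>
      (hFmeas n z t).aestronglyMeasurable).2 fun φ hφ => ?_
    obtain ⟨ψ, hψ, herr⟩ := hsub φ hφ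
    refine ⟨ψ, hψ, ?_⟩
    filter_upwards [hindexlim, herr, ae_all_iff.2 hest,
      DSIM.ae_typical hspread α₀ t hlaw hindep] with ω hω hω' hωest hωtyp
    exact hωtyp.tendsto_fit hconv hbdd hspread hmodel hno
      (hφ.comp hψ).tendsto_atTop (hω (fun l => φ (ψ l)) hω') ht
      (fun l => hωest (φ (ψ l))) hz hcont'
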